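/- Theorem (NP-hardness of parameterised reachability). Let $G$ be a finite alphabet. A non-atomic pushdown system (naPDS) over $G$ consists of a finite set of control states, a finite stack alphabet with a bottom-of-stack symbol $\bot$, an initial control state $q_0$, and a finite set of rules $(q,a)\xrightarrow{\;\ell\;}(q',v)$, where $q,q'$ are control states, $a$ is a stack symbol, $v$ is a word of stack symbols, and the label $\ell$ is $r(g)$ (read $g$), $w(g)$ (write $g$) with $g\in G$, or $\varepsilon$; the symbol $\bot$ is neither pushed nor popped. Such a rule transforms the local configuration $(q,au)$ into $(q',vu)$. A configuration of a network of naPDSs over $G$ consists of a local configuration of every process and a value $g\in G$ of the single global store. In one transition exactly one process applies one of its rules: a rule labelled $\varepsilon$ leaves the store unchanged, a rule labelled $r(h)$ is applicable only if the store value is $h$ and leaves it unchanged, and a rule labelled $w(h)$ sets the store to $h$. Initially, every process is in its initial control state with stack $\bot$, and the store holds a given value $g_0$. The single-store parameterised reachability problem is: given a finite alphabet $G$, two naPDSs (a master $\mathcal U$ and a slave $\mathcal C$) over $G$, a value $g_0\in G$ and a control state $q$ (of $\mathcal U$ or of $\mathcal C$), is there an $n$ such that the network consisting of $\mathcal U$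 and $n$ copies of $\mathcal C$, with initial store value $g_0$, has a run to some configuration in which some process is in the control state $q$? Instances are given explicitly, as words over $\{0,1\}$ in which all components are listed and numbers are written in unary. The single-store parameterised reachability problem is NP-hard: every language in NP has a polynomial-time many-one reduction to it. This remains true when the stacks are removed, that is, when the problem is restricted to the instances in which, for both $\mathcal U$ and $\mathcal C$, the bottom symbol $\bot$ is the only stack symbol and every rule leaves the stack unchanged. -/

import Mathlib

/-! ### Polynomial time, NP and NP-hardness -/

namespace Complexity

/-- `R` is decided by a deterministic machine in time polynomial in the length of the pair.
A pair of words is presented as their concatenation over two disjoint copies of `{0, 1}`. -/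
def PolyTimeRelation (R : List Bool × List Bool → Bool) : Prop :=
  Nonempty (Turing.TM2ComputableInPolyTime
    (Computability.encodingProd (Computability.encodingList Bool)
      (Computability.encodingList Bool)).encode
    Computability.encodingBoolBool.encode R)

/-- The class NP: membership has certificates of polynomial length that can be
checked in polynomial time. -/
def InNP (L : Language Bool) : Prop :=
  ∃ (p : Polynomial ℕ) (R : List Bool × List Bool → Bool),
    PolyTimeRelation R ∧
      ∀ x : List Bool, x ∈ L ↔ ∃ y : List Bool, y.length ≤ p.eval x.length ∧ R (x, y) = true

/-- The decision problem "given an instance `I`, does `Q I` hold?", whose instances are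
presented to machines through the encoding `e`, is NP-hard: every language in NP has a
polynomial-time many-one reduction to it. -/
def NPHard {α : Type} (e : Computability.Encoding α Bool) (Q : α → Prop) : Prop :=
  ∀ L : Language Bool, InNP L →
    ∃ f : List Bool → α,
      Nonempty (Turing.TM2ComputableInPolyTime
        (Computability.encodingList Bool).encode e.encode f) ∧
      ∀ x : List Bool, x ∈ L ↔ Q (f x)

/-- The encoding of a class of instances inside a larger one. -/
def subtypeEncoding {α : Type} (e : Computability.Encoding α Bool) (p : α → Prop)
    [DecidablePred p] : Computability.Encoding {x : α // p x} Bool where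
  encode x := e.encode x.1
  decode w := (e.decode w).bind fun a => if h : p a then some ⟨a, h⟩ else none
  decode_encode x := by
    simp [x.2]

end Complexity

/-! ### Non-atomic pushdown systems and their networks -/

namespace NonAtomic

/-- The labels of transition rules: silent, read the value `g`, write the value `g`. -/
inductive Action (G : Type) where
  | silent : Action G
  | read (g : G) : Action G
  | write (g : G) : Action G

/-- A rule `(source, top) --label--> (target, word)` over control states `Q`, stack symbols `S`. -/
structure Rule (Q S G : Type) where
  source : Q
  top : S
  label : Action G
  target : Q
  word : List S

/-- `bot` is neither pushed nor popped by the rule. -/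
def Rule.PreservesBottom {Q S G : Type} (bot : S) (r : Rule Q S G) : Prop :=
  (r.top ≠ bot → bot ∉ r.word) ∧
    (r.top = bot → ∃ w : List S, bot ∉ w ∧ r.word = w ++ [bot])

/-- A non-atomic pushdown system over the store alphabet `G`. The control states are
`Fin numControls`; the stack alphabet is `Fin (numSymbols + 1)`, its element `0` being the
bottom-of-stack symbol. The finite set of rules is given by a list. -/
structure NaPDS (G : Type) where
  numControls : ℕ
  numSymbols : ℕ
  init : Fin numControls
  rules : List (Rule (Fin numControls) (Fin (numSymbols + 1)) G)
  preservesBottom : ∀ r ∈ rules, r.PreservesBottom 0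

namespace NaPDS

variable {G : Type}

/-- A control state together with the stack contents, top of stack first. -/
abbrev LocalConfig (P : NaPDS G) : Type := Fin P.numControls × List (Fin (P.numSymbols + 1))

def initConfig (P : NaPDS G) : P.LocalConfig := (P.init, [0])

def LocalStep (P : NaPDS G) (c : P.LocalConfig) (a : Action G) (c' : P.LocalConfig) : Prop :=
  ∃ r ∈ P.rules, r.label = a ∧ ∃ u : List (Fin (P.numSymbols + 1)),
    c = (r.source, r.top :: u) ∧ c' = (r.target, r.word ++ u)

/-- The system has no stack: the bottom-of-stack symbol is the only stack symbol, and every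
rule leaves the stack as it is. -/
def Stackless (P : NaPDS G) : Prop :=
  P.numSymbols = 0 ∧ ∀ r ∈ P.rules, r.word = [r.top]

end NaPDS

section Network

variable {G : Type} {ι : Type}

/-- A configuration of the network with processes `P i`: the local configurations and the
value of the global store. -/
structure Config (P : ι → NaPDS G) where
  local_ : ∀ i : ι, (P i).LocalConfig
  store : G

/-- The effect of an action on the global store: from value `g` to value `g'`. -/
def storeEffect : Action G → G → G → Prop
  | .silent, g, g' => g' = g
  | .read h, g, g' => h = g ∧ g' = g
  | .write h, _, g' => g' = h

/-- One transition of the network: one process moves, performing one action. -/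
def Step (P : ι → NaPDS G) (c c' : Config P) : Prop :=
  ∃ (i : ι) (a : Action G),
    (P i).LocalStep (c.local_ i) a (c'.local_ i) ∧
    (∀ j : ι, j ≠ i → c'.local_ j = c.local_ j) ∧
    storeEffect a c.store c'.store

def initialConfig (P : ι → NaPDS G) (g₀ : G) : Config P where
  local_ i := (P i).initConfig
  store := g₀

/-- The network has a run (a path from the initial configuration) ending in `c`. -/
def HasRunTo (P : ι → NaPDS G) (g₀ : G) (c : Config P) : Prop :=
  Relation.ReflTransGen (Step P) (initialConfig P g₀) c

/-- The processes of the network of one master (index `none`) and `n` copies of the slave. -/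
def masterSlaves (M S : NaPDS G) (n : ℕ) : Option (Fin n) → NaPDS G
  | none => M
  | some _ => S

/-- The configuration contains the control state `q`, a control state of the master or of
the slave. -/
def ContainsControl (M S : NaPDS G) (n : ℕ) (c : Config (masterSlaves M S n)) :
    Fin M.numControls ⊕ Fin S.numControls → Prop
  | .inl q => (c.local_ none).1 = q
  | .inr q => ∃ i : Fin n, (c.local_ (some i)).1 = q

end Network

/-! ### The parameterised reachability problem -/

/-- An instance: a finite store alphabet `Fin numValues`, a master and a slave over it, an
initial store value and a control state. -/
structure Instance where
  numValues : ℕ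
  master : NaPDS (Fin numValues)
  slave : NaPDS (Fin numValues)
  initStore : Fin numValues
  goal : Fin master.numControls ⊕ Fin slave.numControls

/-- The answer is "yes": for some `n`, the network of the master and `n` slaves has a run to
some configuration containing the control state. -/
def Instance.Reachable (I : Instance) : Prop :=
  ∃ (n : ℕ) (c : Config (masterSlaves I.master I.slave n)),
    HasRunTo (masterSlaves I.master I.slave n) I.initStore c ∧
      ContainsControl I.master I.slave n c I.goal

/-- The instances in which the stacks have been removed. -/
def Instance.Stackless (I : Instance) : Prop :=
  I.master.Stackless ∧ I.slave.Stackless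

instance : DecidablePred Instance.Stackless := fun I => by
  unfold Instance.Stackless NaPDS.Stackless
  infer_instance

/-! ### The encoding of instances as words

Everything is written out explicitly; numbers are in unary, so that the length of the code is
polynomially related to the number of control states, symbols, store values and rules (and the
lengths of the words in the rules). -/

def encNat (n : ℕ) : List Bool := List.replicate n true ++ [false]

/-- Each element is announced by `true`, and the list ends in `false`. -/
def encList {α : Type} (f : α → List Bool) : List α → List Bool
  | [] => [false]
  | x :: l => true :: (f x ++ encList f l)

def encFin {n : ℕ} (i : Fin n) : List Bool := encNat i.val

def encAction {m : ℕ} : Action (Fin m) → List Bool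
  | .silent => [false]
  | .read g => true :: false :: encFin g
  | .write g => true :: true :: encFin g

def encRule {k s m : ℕ} (r : Rule (Fin k) (Fin s) (Fin m)) : List Bool :=
  encFin r.source ++ encFin r.top ++ encAction r.label ++ encFin r.target ++ encList encFin r.word

def encNaPDS {m : ℕ} (P : NaPDS (Fin m)) : List Bool :=
  encNat P.numControls ++ encNat P.numSymbols ++ encFin P.init ++ encList encRule P.rules

def encGoal {k s : ℕ} : Fin k ⊕ Fin s → List Bool
  | .inl q => false :: encFin q
  | .inr q => true :: encFin q

def encInstance (I : Instance) : List Bool :=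
  encNat I.numValues ++ encNaPDS I.master ++ encNaPDS I.slave ++ encFin I.initStore ++
    encGoal I.goal

/-- Codes can be read off unambiguously from the front of a word. -/
def Prefix {α : Type} (f : α → List Bool) : Prop :=
  ∀ (a b : α) (s t : List Bool), f a ++ s = f b ++ t → a = b ∧ s = t

theorem prefix_encNat : Prefix encNat := by
  intro a
  induction a with
  | zero =>
    intro b s t h
    cases b with
    | zero => simpa [encNat] using h
    | succ b => simp [encNat, List.replicate_succ] at h
  | succ a ih =>
    intro b s t h
    cases b with
    | zero => simp [encNat, List.replicate_succ] at h
    | succ b =>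
      have := ih b s t (by simpa [encNat, List.replicate_succ] using h)
      exact ⟨congrArg Nat.succ this.1, this.2⟩

theorem prefix_encFin {n : ℕ} : Prefix (encFin (n := n)) := by
  intro a b s t h
  obtain ⟨h1, h2⟩ := prefix_encNat _ _ _ _ h
  exact ⟨Fin.ext h1, h2⟩

theorem prefix_encList {α : Type} {f : α → List Bool} (hf : Prefix f) : Prefix (encList f) := by
  intro a
  induction a with
  | nil =>
    intro b s t h
    cases b with
    | nil => simpa [encList] using h
    | cons y b => simp [encList] at h
  | cons x a ih =>
    intro b s t h
    cases b with
    | nil => simp [encList] at h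
    | cons y b =>
      simp only [encList, List.cons_append, List.append_assoc, List.cons.injEq, true_and] at h
      obtain ⟨rfl, h1⟩ := hf _ _ _ _ h
      obtain ⟨rfl, h2⟩ := ih _ _ _ h1
      exact ⟨rfl, h2⟩

theorem prefix_encAction {m : ℕ} : Prefix (encAction (m := m)) := by
  intro a b s t h
  cases a <;> cases b <;> simp [encAction] at h ⊢
  · exact h
  · exact prefix_encFin _ _ _ _ h
  · exact prefix_encFin _ _ _ _ h

theorem prefix_encGoal {k s : ℕ} : Prefix (encGoal (k := k) (s := s)) := by
  intro a b s t h
  cases a <;> cases b <;> simp [encGoal] at h ⊢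
  · exact prefix_encFin _ _ _ _ h
  · exact prefix_encFin _ _ _ _ h

theorem prefix_encRule {k s m : ℕ} : Prefix (encRule (k := k) (s := s) (m := m)) := by
  rintro ⟨a1, a2, a3, a4, a5⟩ ⟨b1, b2, b3, b4, b5⟩ s t h
  simp only [encRule, List.append_assoc] at h
  obtain ⟨rfl, h1⟩ := prefix_encFin _ _ _ _ h
  obtain ⟨rfl, h2⟩ := prefix_encFin _ _ _ _ h1
  obtain ⟨rfl, h3⟩ := prefix_encAction _ _ _ _ h2
  obtain ⟨rfl, h4⟩ := prefix_encFin _ _ _ _ h3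
  obtain ⟨rfl, h5⟩ := prefix_encList prefix_encFin _ _ _ _ h4
  exact ⟨rfl, h5⟩

theorem prefix_encNaPDS {m : ℕ} : Prefix (encNaPDS (m := m)) := by
  rintro ⟨a1, a2, a3, a4, _⟩ ⟨b1, b2, b3, b4, _⟩ s t h
  simp only [encNaPDS, List.append_assoc] at h
  obtain ⟨rfl, h1⟩ := prefix_encNat _ _ _ _ h
  obtain ⟨rfl, h2⟩ := prefix_encNat _ _ _ _ h1
  obtain ⟨rfl, h3⟩ := prefix_encFin _ _ _ _ h2
  obtain ⟨rfl, h4⟩ := prefix_encList prefix_encRule _ _ _ _ h3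
  exact ⟨rfl, h4⟩

theorem encInstance_injective : Function.Injective encInstance := by
  rintro ⟨a1, a2, a3, a4, a5⟩ ⟨b1, b2, b3, b4, b5⟩ h
  simp only [encInstance, List.append_assoc] at h
  obtain ⟨rfl, h1⟩ := prefix_encNat _ _ _ _ h
  obtain ⟨rfl, h2⟩ := prefix_encNaPDS _ _ _ _ h1
  obtain ⟨rfl, h3⟩ := prefix_encNaPDS _ _ _ _ h2
  obtain ⟨rfl, h4⟩ := prefix_encFin _ _ _ _ h3
  obtain ⟨rfl, -⟩ := prefix_encGoal _ _ [] [] (by simpa using h4)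
  rfl

noncomputable def instanceEncoding : Computability.Encoding Instance Bool where
  encode := encInstance
  decode := Function.partialInv encInstance
  decode_encode := Function.partialInv_left encInstance_injective

end NonAtomic

/-! The slaves serve only as memory. A slave can copy the current store value and write it back at
any later moment. With one slave per value, everything that has ever been in the store can be
supplied to the master again; conversely, slaves never produce a value that has not been in the
store before. So the network behaves like the master alone with a growing set of facts, a value
being readable once it has been written or if it is the initial one
(`reachable_memoryInstance_iff`).

Such a memory never forgets, and apart from it the master has only its polynomially many control
states. The computation is therefore arranged so that nothing is overwritten. A queue machine that
removes one letter and appends one letter per step has a history that is a single append-only tape,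
and "cell `i` holds `a`" is the fact `(i, a)`. Each cell is written once, so the facts determine the
tape. The queue has constant length, so the write position kept in the state of the master also
determines the read position. The master writes the input, guesses a certificate, pads with blanks
and then simulates the queue machine (`QueueMachine.factReach_iff`).

A polynomial-time verifier, given as a multi-stack machine, becomes a queue machine by holding its
stacks as parallel tracks of one row: each instruction shifts at most one track by one cell while
the row passes once through the queue. Shifting towards the top requires guessing the next symbol;
the guess is checked at the next cell or at the separator (`queueRun_of_stepsTo`,
`accepts_of_queueRun`). Stack alphabets of the verifier may be infinite, but only input symbols and
results of push statements in finitely many internal states occur, and these form a finite alphabet.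

The instance must also be written down by an actual machine in polynomial time. The numbers in its
rules are affine forms in a loop counter and a base number that is polynomial in the input length.
Hence a language of pushes and loops over stacks, compiled to stack machines (`polyTime_of_run`),
suffices, and one generator handles all rules (`Generator.polyRun_prog`). Neither master nor slave
uses a stack, so one reduction proves both claims. -/

/-! ### A small imperative language compiled to stack machines -/

namespace StackProg

open Function StateTransition Turing

/-- Programs over stacks of bits. `loop k p q` pops stack `k` until it is empty, running `p` after
popping `false` and `q` after popping `true`. -/
inductive Prog (K : Type) where
  | skip : Prog K
  | push (k : K) (b : Bool) : Prog K
  | seq (p q : Prog K) : Prog K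
  | loop (k : K) (p q : Prog K) : Prog K

abbrev Store (K : Type) : Type := K → List Bool

/-- `Exec p s t n`: started in `s`, the program `p` ends in `t` after `n` steps. -/
inductive Exec {K : Type} [DecidableEq K] : Prog K → Store K → Store K → ℕ → Prop
  | skip (s : Store K) : Exec .skip s s 1
  | push (k : K) (b : Bool) (s : Store K) : Exec (.push k b) s (update s k (b :: s k)) 1
  | seq {p q : Prog K} {s t u : Store K} {m n : ℕ} :
      Exec p s t m → Exec q t u n → Exec (.seq p q) s u (m + n)
  | loop_nil {k : K} {p q : Prog K} {s : Store K} : s k = [] → Exec (.loop k p q) s s 1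
  | loop_cons {k : K} {p q : Prog K} {s t u : Store K} {b : Bool} {l : List Bool} {m n : ℕ} :
      s k = b :: l → Exec (bif b then q else p) (update s k l) t m →
      Exec (.loop k p q) t u n → Exec (.loop k p q) s u (1 + m + n)

namespace Prog

variable {K : Type}

/-- The control points of a program. -/
def Label : Prog K → Type
  | skip => Unit
  | push _ _ => Unit
  | seq p q => p.Label ⊕ q.Label
  | loop _ p q => Option (p.Label ⊕ q.Label)

instance finiteLabel : (p : Prog K) → Finite p.Label
  | skip => inferInstanceAs (Finite Unit)
  | push _ _ => inferInstanceAs (Finite Unit)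
  | seq p q =>
    have := finiteLabel p
    have := finiteLabel q
    inferInstanceAs (Finite (p.Label ⊕ q.Label))
  | loop _ p q =>
    have := finiteLabel p
    have := finiteLabel q
    inferInstanceAs (Finite (Option (p.Label ⊕ q.Label)))

def entry : (p : Prog K) → p.Label
  | skip => ()
  | push _ _ => ()
  | seq p _ => Sum.inl p.entry
  | loop _ _ _ => none

abbrev BitStmt (K Λ : Type) : Type := TM2.Stmt (fun _ : K => Bool) Λ (Option Bool)

/-- The code of `p`, with labels embedded by `emb` and leaving `p` by a jump to `exit`. -/
def code {Λ : Type} : (p : Prog K) → (p.Label → Λ) → Λ → p.Label → BitStmt K Λ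
  | skip, _, exit, _ => .goto fun _ => exit
  | push k b, _, exit, _ => .push k (fun _ => b) (.goto fun _ => exit)
  | seq p q, emb, exit, l =>
    match l with
    | Sum.inl l => p.code (fun l => emb (Sum.inl l)) (emb (Sum.inr q.entry)) l
    | Sum.inr l => q.code (fun l => emb (Sum.inr l)) exit l
  | loop k p q, emb, exit, l =>
    match l with
    | none => .pop k (fun _ b => b) (.goto fun v => match v with
      | none => exit
      | some false => emb (some (Sum.inl p.entry))
      | some true => emb (some (Sum.inr q.entry)))
    | some (Sum.inl l) => p.code (fun l => emb (some (Sum.inl l))) (emb none) l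
    | some (Sum.inr l) => q.code (fun l => emb (some (Sum.inr l))) (emb none) l

end Prog

/-- `f` leads from `a` to `b` in exactly `n` steps. -/
def StepsTo {σ : Type} (f : σ → Option σ) (a : σ) (n : ℕ) (b : σ) : Prop :=
  (flip bind f)^[n] (some a) = some b

theorem StepsTo.trans {σ : Type} {f : σ → Option σ} {a b c : σ} {m n : ℕ}
    (h : StepsTo f a m b) (h' : StepsTo f b n c) : StepsTo f a (m + n) c := by
  unfold StepsTo at *
  rw [Nat.add_comm, Function.iterate_add_apply, h, h']

theorem StepsTo.single {σ : Type} {f : σ → Option σ} {a b : σ} (h : f a = some b) :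
    StepsTo f a 1 b := h

variable {K : Type} [DecidableEq K]

/-- Quantifying over the embedding of labels and over the exit makes the induction work: a
subprogram is the same code placed elsewhere with another exit. The final internal state is left
open because it records the last popped bit. -/
theorem Exec.stepsTo {Λ : Type} (m : Λ → Prog.BitStmt K Λ) {p : Prog K} {s t : Store K} {n : ℕ}
    (h : Exec p s t n) :
    ∀ (emb : p.Label → Λ) (exit : Λ), (∀ l, m (emb l) = p.code emb exit l) →
      ∀ v, ∃ v', StepsTo (TM2.step m) ⟨some (emb p.entry), v, s⟩ n ⟨some exit, v', t⟩ := by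
  induction h with
  | skip s =>
    intro emb exit hm v
    refine ⟨v, StepsTo.single ?_⟩
    simp [TM2.step, hm, Prog.code]
  | push k b s =>
    intro emb exit hm v
    refine ⟨v, StepsTo.single ?_⟩
    simp [TM2.step, hm, Prog.code]
  | seq h1 h2 ih1 ih2 =>
    intro emb exit hm v
    obtain ⟨v1, e1⟩ := ih1 _ _ (fun l => hm (Sum.inl l)) v
    obtain ⟨v2, e2⟩ := ih2 _ _ (fun l => hm (Sum.inr l)) v1
    exact ⟨v2, e1.trans e2⟩
  | @loop_nil k p q s hk =>
    intro emb exit hm v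
    refine ⟨none, StepsTo.single ?_⟩
    have h0 := hm none
    simp only [Prog.code] at h0
    simp only [TM2.step, Prog.entry, h0, TM2.stepAux, hk, List.head?_nil, List.tail_nil]
    rw [show update s k [] = s by rw [← hk, update_eq_self]]
  | @loop_cons k p q s t u b l m' n' hk h1 h2 ih1 ih2 =>
    intro emb exit hm v
    have h0 := hm none
    simp only [Prog.code] at h0
    have hfirst : ∀ w : Λ, w = (match b with
        | false => emb (some (Sum.inl p.entry))
        | true => emb (some (Sum.inr q.entry))) →
        StepsTo (TM2.step m) ⟨some (emb (Prog.loop k p q).entry), v, s⟩ 1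
          ⟨some w, some b, update s k l⟩ := by
      intro w hw
      apply StepsTo.single
      simp only [TM2.step, Prog.entry, h0, TM2.stepAux, hk, List.head?_cons, List.tail_cons, hw]
      cases b <;> rfl
    cases b with
    | false =>
      obtain ⟨v1, e1⟩ := ih1 _ _ (fun l => hm (some (Sum.inl l))) (some false)
      obtain ⟨v2, e2⟩ := ih2 emb exit hm v1
      exact ⟨v2, ((hfirst _ rfl).trans e1).trans e2⟩
    | true =>
      obtain ⟨v1, e1⟩ := ih1 _ _ (fun l => hm (some (Sum.inr l))) (some true)
      obtain ⟨v2, e2⟩ := ih2 emb exit hm v1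
      exact ⟨v2, ((hfirst _ rfl).trans e1).trans e2⟩

/-- The stack machine running `p` and then halting. -/
noncomputable def Prog.machine [Fintype K] (p : Prog K) (k₀ k₁ : K) : FinTM2 where
  K := K
  k₀ := k₀
  k₁ := k₁
  Γ _ := Bool
  Λ := Option p.Label
  main := some p.entry
  ΛFin := Fintype.ofFinite _
  σ := Option Bool
  initialState := none
  m l := match l with
    -- The halting configuration is required to have the initial internal state, so the last popped
    -- bit is erased.
    | none => .load (fun _ => none) .halt
    | some l => p.code some none l

/-- The store with the word `w` on stack `k` and all other stacks empty. -/
def single (k : K) (w : List Bool) : Store K := update (fun _ => []) k w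

theorem single_eq {k k' : K} {w : List Bool} (h : k' = k) : single k w k' = w := by
  simp [single, h]

theorem single_ne {k k' : K} {w : List Bool} (h : k' ≠ k) : single k w k' = [] := by
  simp [single, h]

/-- `Run p s t c`: started in `s`, the program `p` ends in `t` after at most `c` steps. -/
def Run (p : Prog K) (s t : Store K) (c : ℕ) : Prop := ∃ n ≤ c, Exec p s t n

/-- This is the bridge from programs to polynomial-time computability. The run has to end with every
stack but the output stack empty; the summand `1` in the time bound pays for the final reset and
halt. -/
theorem polyTime_of_run [Fintype K] {α : Type} (p : Prog K) (k₀ k₁ : K) (enc : α → List Bool)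
    (f : List Bool → α) (c : Polynomial ℕ)
    (h : ∀ x, Run p (single k₀ x) (single k₁ (enc (f x))) (c.eval x.length)) :
    Nonempty (TM2ComputableInPolyTime (Computability.encodingList Bool).encode enc f) := by
  refine ⟨{ tm := p.machine k₀ k₁, inputAlphabet := Equiv.refl _, outputAlphabet := Equiv.refl _,
            time := c + 1, outputsFun := fun x => ?_ }⟩
  have h1 : ∃ n ≤ c.eval x.length + 1, StepsTo (p.machine k₀ k₁).step
      (initList (p.machine k₀ k₁) x) n (haltList (p.machine k₀ k₁) (enc (f x))) := by
    obtain ⟨n, hn, he⟩ := h x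
    obtain ⟨v, e⟩ := he.stepsTo (p.machine k₀ k₁).m some none (fun _ => rfl) none
    have hi : initList (p.machine k₀ k₁) x =
        (⟨some (some p.entry), none, single k₀ x⟩ : TM2.Cfg _ _ _) := by
      unfold initList
      congr 1
      funext k
      by_cases hk : k = k₀
      · exact (dif_pos hk).trans (single_eq hk).symm
      · exact (dif_neg hk).trans (single_ne hk).symm
    have ho : haltList (p.machine k₀ k₁) (enc (f x)) =
        (⟨none, none, single k₁ (enc (f x))⟩ : TM2.Cfg _ _ _) := by
      unfold haltList
      congr 1
      funext k
      by_cases hk : k = k₁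
      · exact (dif_pos hk).trans (single_eq hk).symm
      · exact (dif_neg hk).trans (single_ne hk).symm
    refine ⟨n + 1, by omega, ?_⟩
    rw [hi, ho]
    exact e.trans (StepsTo.single rfl)
  have hx : (Computability.encodingList Bool).encode x = x := rfl
  refine ⟨⟨h1.choose, ?_⟩, ?_⟩
  · have := h1.choose_spec.2
    simp only [hx, Equiv.invFun_as_coe, Equiv.refl_symm]
    simp only [StepsTo] at this
    erw [List.map_id, List.map_id]
    exact this
  · simpa [hx] using h1.choose_spec.1

end StackProg

/-! ### Running times of programs and unary arithmetic on stacks -/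

namespace StackProg

open Function

section Run

variable {K : Type} [DecidableEq K]

theorem Run.mono {p : Prog K} {s t : Store K} {c d : ℕ} (h : Run p s t c) (hcd : c ≤ d) :
    Run p s t d :=
  let ⟨n, hn, he⟩ := h
  ⟨n, hn.trans hcd, he⟩

theorem Run.congr {p : Prog K} {s s' t t' : Store K} {c : ℕ} (h : Run p s t c) (hs : s = s')
    (ht : t = t') : Run p s' t' c := hs ▸ ht ▸ h

theorem Run.skip (s : Store K) : Run .skip s s 1 := ⟨1, le_rfl, .skip s⟩

theorem Run.push (k : K) (b : Bool) (s : Store K) :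
    Run (.push k b) s (update s k (b :: s k)) 1 := ⟨1, le_rfl, .push k b s⟩

theorem Run.seq {p q : Prog K} {s t u : Store K} {c d : ℕ} (h : Run p s t c) (h' : Run q t u d) :
    Run (.seq p q) s u (c + d) :=
  let ⟨m, hm, he⟩ := h
  let ⟨n, hn, he'⟩ := h'
  ⟨m + n, by omega, .seq he he'⟩

/-- A loop over the word `w`: the store is `F i` when `i` letters have been popped. -/
theorem Run.loop {k : K} {p q : Prog K} {c : ℕ} :
    ∀ (w : List Bool) (F : ℕ → Store K), (∀ i ≤ w.length, F i k = w.drop i) →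
      (∀ i (hi : i < w.length), Run (bif w[i] then q else p) (update (F i) k (w.drop (i + 1)))
        (F (i + 1)) c) →
      Run (.loop k p q) (F 0) (F w.length) (1 + w.length * (1 + c))
  | [], F, hF, _ => ⟨1, by simp, .loop_nil (by simpa using hF 0)⟩
  | b :: w, F, hF, hs => by
    obtain ⟨m, hm, he⟩ := hs 0 (by simp)
    obtain ⟨n, hn, he'⟩ := Run.loop w (fun i => F (i + 1))
      (fun i hi => by simpa using hF (i + 1) (by simpa using hi))
      (fun i hi => hs (i + 1) (Nat.succ_lt_succ hi))
    refine ⟨1 + m + n, ?_, .loop_cons (b := b) (l := w) (by simpa using hF 0)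
      (by simpa using he) he'⟩
    simp only [List.length_cons]
    nlinarith

/-- Run `p` once for each letter of stack `k`. -/
def each (k : K) (p : Prog K) : Prog K := .loop k p p

theorem Run.each {k : K} {p : Prog K} {c : ℕ} (w : List Bool) (F : ℕ → Store K)
    (hF : ∀ i ≤ w.length, F i k = w.drop i)
    (hs : ∀ i < w.length, Run p (update (F i) k (w.drop (i + 1))) (F (i + 1)) c) :
    Run (each k p) (F 0) (F w.length) (1 + w.length * (1 + c)) :=
  Run.loop w F hF fun i hi => by simpa using hs i hi

end Run

/-- The stacks of the generator of instances. -/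
inductive Reg
  | inp | out | tmp | idx | len | base | cnt | aux
  deriving DecidableEq

instance : Fintype Reg where
  elems := {.inp, .out, .tmp, .idx, .len, .base, .cnt, .aux}
  complete k := by cases k <;> decide

/-- The store with the given stacks. -/
def mk (inp out tmp idx len base cnt aux : List Bool) : Store Reg
  | .inp => inp
  | .out => out
  | .tmp => tmp
  | .idx => idx
  | .len => len
  | .base => base
  | .cnt => cnt
  | .aux => aux

section mk

variable (a b c d e f g h x : List Bool)

@[simp] theorem mk_inp : mk a b c d e f g h .inp = a := rfl
@[simp] theorem mk_out : mk a b c d e f g h .out = b := rfl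
@[simp] theorem mk_tmp : mk a b c d e f g h .tmp = c := rfl
@[simp] theorem mk_idx : mk a b c d e f g h .idx = d := rfl
@[simp] theorem mk_len : mk a b c d e f g h .len = e := rfl
@[simp] theorem mk_base : mk a b c d e f g h .base = f := rfl
@[simp] theorem mk_cnt : mk a b c d e f g h .cnt = g := rfl
@[simp] theorem mk_aux : mk a b c d e f g h .aux = h := rfl

@[simp] theorem update_inp : update (mk a b c d e f g h) .inp x = mk x b c d e f g h := by
  funext k; cases k <;> rfl
@[simp] theorem update_out : update (mk a b c d e f g h) .out x = mk a x c d e f g h := by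
  funext k; cases k <;> rfl
@[simp] theorem update_idx : update (mk a b c d e f g h) .idx x = mk a b c x e f g h := by
  funext k; cases k <;> rfl
@[simp] theorem update_len : update (mk a b c d e f g h) .len x = mk a b c d x f g h := by
  funext k; cases k <;> rfl
@[simp] theorem update_base : update (mk a b c d e f g h) .base x = mk a b c d e x g h := by
  funext k; cases k <;> rfl
@[simp] theorem update_cnt : update (mk a b c d e f g h) .cnt x = mk a b c d e f x h := by
  funext k; cases k <;> rfl
@[simp] theorem update_aux : update (mk a b c d e f g h) .aux x = mk a b c d e f g x := by
  funext k; cases k <;> rfl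

end mk

theorem single_inp (x : List Bool) : single Reg.inp x = mk x [] [] [] [] [] [] [] := by
  funext k; cases k <;> rfl

theorem single_out (x : List Bool) : single Reg.out x = mk [] x [] [] [] [] [] [] := by
  funext k; cases k <;> rfl

/-- The number `n` in unary. -/
def unary (n : ℕ) : List Bool := List.replicate n true

@[simp] theorem length_unary (n : ℕ) : (unary n).length = n := List.length_replicate

@[simp] theorem drop_unary (n i : ℕ) : (unary n).drop i = unary (n - i) := by simp [unary]

@[simp] theorem cons_unary (n : ℕ) : true :: unary n = unary (n + 1) := rfl

@[simp] theorem unary_append (m n : ℕ) : unary m ++ unary n = unary (m + n) := by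
  simp [unary]

@[simp] theorem unary_zero : unary 0 = [] := rfl

theorem cons_unary_append (n : ℕ) (l : List Bool) : true :: (unary n ++ l) = unary (n + 1) ++ l :=
  rfl

theorem encNat_eq (n : ℕ) : NonAtomic.encNat n = unary n ++ [false] := rfl

/-- Add the number on stack `u` to stack `k`. -/
def addReg (u k : Reg) : Prog Reg :=
  .seq (each u (.seq (.push .tmp true) (.push k true))) (each .tmp (.push u true))

/-- A loop destroys the stack that controls it, so `u` is moved to `tmp` while `k` grows, and a
second loop restores `u`. The two loops cost `1 + 3 * m` and `1 + 2 * m`. -/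
theorem run_addReg {u k : Reg} (huk : u ≠ k) (hu : u ≠ .tmp) (hk : k ≠ .tmp) (s : Store Reg)
    {m : ℕ} (hsu : s u = unary m) (hst : s .tmp = []) :
    Run (addReg u k) s (update s k (unary m ++ s k)) (2 + 5 * m) := by
  have h1 := Run.each (k := u) (p := .seq (.push .tmp true) (.push k true)) (c := 2) (unary m)
    (fun i => update (update (update s u (unary (m - i))) .tmp (unary i)) k (unary i ++ s k))
    (by intro i hi; simp [huk, hu]) (by
      intro i hi
      refine ((Run.push _ _ _).seq (Run.push _ _ _)).congr rfl ?_
      funext j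
      simp only [update_apply]
      split_ifs <;> simp_all [cons_unary_append])
  have h2 := Run.each (k := .tmp) (p := .push u true) (c := 1) (unary m)
    (fun i => update (update (update s u (unary i)) .tmp (unary (m - i))) k (unary m ++ s k))
    (by intro i hi; simp [hk.symm]) (by
      intro i hi
      refine (Run.push _ _ _).congr rfl ?_
      funext j
      simp only [update_apply]
      split_ifs <;> simp_all)
  refine (((h1.congr ?_ ?_).seq h2).congr rfl ?_).mono (by simp; omega)
  · funext j
    simp only [update_apply]
    split_ifs <;> simp_all
  · simp
  · funext j
    simp only [update_apply]
    split_ifs <;> simp_all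

end StackProg

namespace StackProg

open Function NonAtomic

/-! #### Emission of words -/

/-- Put the word `w` on top of stack `k`. -/
def pushes (k : Reg) : List Bool → Prog Reg
  | [] => .skip
  | b :: w => .seq (pushes k w) (.push k b)

theorem run_pushes (k : Reg) (s : Store Reg) :
    ∀ w, Run (pushes k w) s (update s k (w ++ s k)) (w.length + 1)
  | [] => (Run.skip s).congr rfl (by simp)
  | b :: w => (((run_pushes k s w).seq (Run.push k b _)).congr rfl (by simp)).mono (by simp)

/-- The affine form `a * r + b * u + c`, where `r` stands for the stack `idx` and `u` for the
stack `base`. -/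
structure Affine where
  a : ℕ
  b : ℕ
  c : ℕ

def Affine.eval (A : Affine) (r u : ℕ) : ℕ := A.a * r + A.b * u + A.c

/-- The program `p` puts the word `w r u` on the output stack in time linear in the numbers `r`
on the stack `idx` and `u` on the stack `base`. -/
def Emits (p : Prog Reg) (w : ℕ → ℕ → List Bool) : Prop :=
  ∃ κ : ℕ, ∀ (r u : ℕ) (inp out len cnt aux : List Bool),
    Run p (mk inp out [] (unary r) len (unary u) cnt aux)
      (mk inp (w r u ++ out) [] (unary r) len (unary u) cnt aux) (κ * (r + u + 1))

theorem Emits.seq {p q : Prog Reg} {v w : ℕ → ℕ → List Bool} (hp : Emits p v) (hq : Emits q w) :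
    Emits (.seq p q) (fun r u => w r u ++ v r u) := by
  obtain ⟨κ, hp⟩ := hp
  obtain ⟨κ', hq⟩ := hq
  exact ⟨κ + κ', fun r u inp out len cnt aux => (((hp r u inp out len cnt aux).seq
    (hq r u inp _ len cnt aux)).congr rfl (by simp)).mono (by rw [add_mul])⟩

theorem Emits.congr {p : Prog Reg} {v w : ℕ → ℕ → List Bool} (hp : Emits p v)
    (h : ∀ r u, v r u = w r u) : Emits p w := by
  rwa [show v = w from funext fun r => funext fun u => h r u] at hp

theorem emits_pushes (w : List Bool) : Emits (pushes .out w) (fun _ _ => w) :=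
  ⟨w.length + 1, fun _ _ _ _ _ _ _ => ((run_pushes .out _ w).congr rfl (by simp)).mono
    (Nat.le_mul_of_pos_right _ (by omega))⟩

theorem emits_addReg_idx : Emits (addReg .idx .out) (fun r _ => unary r) :=
  ⟨5, fun _ _ _ _ _ _ _ => ((run_addReg (by decide) (by decide) (by decide) _ rfl rfl).congr rfl
    (by simp)).mono (by omega)⟩

theorem emits_addReg_base : Emits (addReg .base .out) (fun _ u => unary u) :=
  ⟨5, fun _ _ _ _ _ _ _ => ((run_addReg (by decide) (by decide) (by decide) _ rfl rfl).congr rfl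
    (by simp)).mono (by omega)⟩

/-- Run `p` repeatedly. -/
def times (p : Prog Reg) : ℕ → Prog Reg
  | 0 => .skip
  | n + 1 => .seq (times p n) p

theorem emits_times {p : Prog Reg} {f : ℕ → ℕ → ℕ} (hp : Emits p (fun r u => unary (f r u))) :
    ∀ a, Emits (times p a) (fun r u => unary (a * f r u))
  | 0 => (emits_pushes []).congr (by simp)
  | a + 1 => ((emits_times hp a).seq hp).congr fun r u => by
      rw [unary_append, Nat.add_mul, Nat.one_mul, Nat.add_comm]

/-- The first letter of the output is the top of the stack, so words are produced from back to front
and the terminating `false` is pushed first. -/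
def emitNat (A : Affine) : Prog Reg :=
  .seq (pushes .out [false]) (.seq (times (addReg .idx .out) A.a)
    (.seq (times (addReg .base .out) A.b) (pushes .out (unary A.c))))

theorem emits_emitNat (A : Affine) : Emits (emitNat A) (fun r u => encNat (A.eval r u)) :=
  ((emits_pushes [false]).seq ((emits_times emits_addReg_idx A.a).seq
    ((emits_times emits_addReg_base A.b).seq (emits_pushes (unary A.c))))).congr fun r u => by
      simp [encNat_eq, Affine.eval, Nat.add_comm, Nat.add_left_comm]

end StackProg

/-! ### Stackless rules and the programs that write their codes -/

namespace NonAtomic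

def Action.map {G H : Type} (f : G → H) : Action G → Action H
  | .silent => .silent
  | .read g => .read (f g)
  | .write g => .write (f g)

/-- A stackless rule: source, label and target. -/
structure Arc (Q G : Type) where
  source : Q
  label : Action G
  target : Q

def Arc.map {Q G Q' G' : Type} (f : Q → Q') (g : G → G') (r : Arc Q G) : Arc Q' G' :=
  ⟨f r.source, r.label.map g, f r.target⟩

def encActionNat : Action ℕ → List Bool
  | .silent => [false]
  | .read g => true :: false :: encNat g
  | .write g => true :: true :: encNat g

/-- The code of an arc as an entry of the list of rules. -/
def encArc (r : Arc ℕ ℕ) : List Bool :=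
  true :: (encNat r.source ++ [false] ++ encActionNat r.label ++ encNat r.target ++
    [true, false, false])

end NonAtomic

namespace StackProg

open Function NonAtomic

def Affine.arc (r u : ℕ) (T : Arc Affine Affine) : Arc ℕ ℕ :=
  T.map (fun A => A.eval r u) (fun A => A.eval r u)

def emitAction : Action Affine → Prog Reg
  | .silent => pushes .out [false]
  | .read A => .seq (emitNat A) (pushes .out [true, false])
  | .write A => .seq (emitNat A) (pushes .out [true, true])

theorem emits_emitAction (α : Action Affine) :
    Emits (emitAction α) (fun r u => encActionNat (α.map fun A => A.eval r u)) := by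
  cases α with
  | silent => exact emits_pushes _
  | read A => exact (emits_emitNat A).seq (emits_pushes _)
  | write A => exact (emits_emitNat A).seq (emits_pushes _)

def emitArc (T : Arc Affine Affine) : Prog Reg :=
  .seq (pushes .out [true, false, false]) (.seq (emitNat T.target)
    (.seq (emitAction T.label) (.seq (pushes .out [false])
      (.seq (emitNat T.source) (pushes .out [true])))))

theorem emits_emitArc (T : Arc Affine Affine) :
    Emits (emitArc T) (fun r u => encArc (Affine.arc r u T)) :=
  ((emits_pushes _).seq ((emits_emitNat T.target).seq ((emits_emitAction T.label).seq
    ((emits_pushes _).seq ((emits_emitNat T.source).seq (emits_pushes _)))))).congr fun r u => by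
      simp [encArc, Affine.arc, Arc.map]

def emitArcs : List (Arc Affine Affine) → Prog Reg
  | [] => .skip
  | T :: l => .seq (emitArcs l) (emitArc T)

def Affine.arcs (l : List (Arc Affine Affine)) (r u : ℕ) : List (Arc ℕ ℕ) := l.map (Affine.arc r u)

theorem emits_emitArcs : ∀ l : List (Arc Affine Affine),
    Emits (emitArcs l) (fun r u => (Affine.arcs l r u).flatMap encArc)
  | [] => emits_pushes []
  | T :: l => ((emits_emitArcs l).seq (emits_emitArc T)).congr fun r u => by
      simp [Affine.arcs]

/-! #### Programs running in polynomial time on stores that depend on a word -/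

def PolyRun (p : Prog Reg) (s t : List Bool → Store Reg) : Prop :=
  ∃ P : Polynomial ℕ, ∀ x, Run p (s x) (t x) (P.eval x.length)

def PolyBounded (f : List Bool → ℕ) : Prop := ∃ P : Polynomial ℕ, ∀ x, f x ≤ P.eval x.length

theorem PolyBounded.const (c : ℕ) : PolyBounded fun _ => c := ⟨Polynomial.C c, by simp⟩

theorem PolyBounded.length : PolyBounded List.length := ⟨Polynomial.X, by simp⟩

theorem PolyBounded.add {f g : List Bool → ℕ} (hf : PolyBounded f) (hg : PolyBounded g) :
    PolyBounded fun x => f x + g x := by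
  obtain ⟨P, hP⟩ := hf
  obtain ⟨Q, hQ⟩ := hg
  exact ⟨P + Q, fun x => by simpa using Nat.add_le_add (hP x) (hQ x)⟩

theorem PolyBounded.mul {f g : List Bool → ℕ} (hf : PolyBounded f) (hg : PolyBounded g) :
    PolyBounded fun x => f x * g x := by
  obtain ⟨P, hP⟩ := hf
  obtain ⟨Q, hQ⟩ := hg
  exact ⟨P * Q, fun x => by simpa using Nat.mul_le_mul (hP x) (hQ x)⟩

theorem PolyRun.of_run {p : Prog Reg} {s t : List Bool → Store Reg} {f : List Bool → ℕ}
    (hf : PolyBounded f) (h : ∀ x, Run p (s x) (t x) (f x)) : PolyRun p s t := by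
  obtain ⟨P, hP⟩ := hf
  exact ⟨P, fun x => (h x).mono (hP x)⟩

theorem PolyRun.seq {p q : Prog Reg} {s t u : List Bool → Store Reg} (hp : PolyRun p s t)
    (hq : PolyRun q t u) : PolyRun (.seq p q) s u := by
  obtain ⟨P, hP⟩ := hp
  obtain ⟨Q, hQ⟩ := hq
  exact ⟨P + Q, fun x => ((hP x).seq (hQ x)).mono (by simp)⟩

theorem PolyRun.congr {p : Prog Reg} {s t t' : List Bool → Store Reg} (h : PolyRun p s t)
    (ht : ∀ x, t x = t' x) : PolyRun p s t' := by
  rwa [show t = t' from funext ht] at h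

/-! #### Loops emitting rules -/

/-- Empty the stack `k`. -/
def clear (k : Reg) : Prog Reg := each k .skip

theorem run_clear (k : Reg) (s : Store Reg) :
    Run (clear k) s (update s k []) (1 + (s k).length * 2) :=
  (Run.each (s k) (fun i => update s k ((s k).drop i)) (by simp) (fun i hi => (Run.skip _).congr
    (by simp) rfl)).congr (by simp) (by simp)

/-- For each `r` below the number on the stack `cnt`, emit the arcs `l`. -/
def forEmit (l : List (Arc Affine Affine)) : Prog Reg :=
  .seq (each .cnt (.seq (emitArcs l) (.push .idx true))) (clear .idx)

/-- The range is reversed because the counter runs upwards while later output lands in front of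
earlier output. -/
def forArcs (l : List (Arc Affine Affine)) (v u : ℕ) : List (Arc ℕ ℕ) :=
  (List.range v).reverse.flatMap fun r => Affine.arcs l r u

theorem forArcs_succ (l : List (Arc Affine Affine)) (v u : ℕ) :
    forArcs l (v + 1) u = Affine.arcs l v u ++ forArcs l v u := by
  simp [forArcs, List.range_succ]

/-- The loop invariant: after `i` rounds `cnt` holds `v - i`, `idx` holds `i`, and the arcs for the
numbers below `i` have been emitted. The final clearing of `idx` makes the block reusable. -/
theorem polyRun_forEmit (l : List (Arc Affine Affine)) {v u : List Bool → ℕ} (hv : PolyBounded v)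
    (hu : PolyBounded u) (inp out len aux : List Bool → List Bool) :
    PolyRun (forEmit l)
      (fun x => mk (inp x) (out x) [] [] (len x) (unary (u x)) (unary (v x)) (aux x))
      (fun x => mk (inp x) ((forArcs l (v x) (u x)).flatMap encArc ++ out x) [] [] (len x)
        (unary (u x)) [] (aux x)) := by
  obtain ⟨κ, h⟩ := emits_emitArcs l
  refine .of_run (f := fun x => (1 + v x * (1 + (κ * (v x + u x + 1) + 1))) + (1 + v x * 2)) ?_ ?_
  · exact (((PolyBounded.const 1).add (hv.mul ((PolyBounded.const 1).add (((PolyBounded.const κ).mul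
      ((hv.add hu).add (.const 1))).add (.const 1))))).add
      ((PolyBounded.const 1).add (hv.mul (.const 2))))
  · intro x
    have h1 := Run.each (k := .cnt) (p := .seq (emitArcs l) (.push .idx true))
      (c := κ * (v x + u x + 1) + 1) (unary (v x))
      (fun i => mk (inp x) ((forArcs l i (u x)).flatMap encArc ++ out x) [] (unary i) (len x)
        (unary (u x)) (unary (v x - i)) (aux x)) (by simp) (by
        intro i hi
        rw [length_unary] at hi
        refine ((((h i (u x) (inp x) ((forArcs l i (u x)).flatMap encArc ++ out x) (len x)
          (unary (v x - (i + 1))) (aux x))).seq (Run.push .idx true _)).congr ?_ ?_).mono ?_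
        · simp
        · simp [forArcs_succ]
        · gcongr)
    simp only [length_unary] at h1
    refine ((h1.seq (run_clear .idx _)).congr ?_ ?_).mono ?_ <;> simp [forArcs]

/-- Pop the input, emitting the arcs `l b` for each bit `b`. -/
def forInput (l : Bool → List (Arc Affine Affine)) : Prog Reg :=
  .seq (.loop .inp (.seq (emitArcs (l false)) (.push .idx true))
    (.seq (emitArcs (l true)) (.push .idx true))) (clear .idx)

/-- The arcs of later letters stand in front, in accordance with the order of emission. -/
def inputArcs (l : Bool → List (Arc Affine Affine)) (u : ℕ) : ℕ → List Bool → List (Arc ℕ ℕ)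
  | _, [] => []
  | j, b :: x => inputArcs l u (j + 1) x ++ Affine.arcs (l b) j u

theorem inputArcs_append (l : Bool → List (Arc Affine Affine)) (u : ℕ) :
    ∀ (j : ℕ) (x y : List Bool),
      inputArcs l u j (x ++ y) = inputArcs l u (j + x.length) y ++ inputArcs l u j x
  | _, [], _ => by simp [inputArcs]
  | j, b :: x, y => by
    simp [inputArcs, inputArcs_append l u (j + 1) x y, Nat.add_comm, Nat.add_left_comm]

theorem polyRun_forInput (l : Bool → List (Arc Affine Affine)) {u : List Bool → ℕ}
    (hu : PolyBounded u) (out len cnt aux : List Bool → List Bool) :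
    PolyRun (forInput l)
      (fun x => mk x (out x) [] [] (len x) (unary (u x)) (cnt x) (aux x))
      (fun x => mk [] ((inputArcs l (u x) 0 x).flatMap encArc ++ out x) [] [] (len x)
        (unary (u x)) (cnt x) (aux x)) := by
  obtain ⟨κ, h⟩ := emits_emitArcs (l false)
  obtain ⟨κ', h'⟩ := emits_emitArcs (l true)
  refine .of_run (f := fun x => (1 + x.length * (1 + ((κ + κ') * (x.length + u x + 1) + 1))) +
    (1 + x.length * 2)) ?_ ?_
  · exact (((PolyBounded.const 1).add (PolyBounded.length.mul ((PolyBounded.const 1).add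
      (((PolyBounded.const (κ + κ')).mul
      ((PolyBounded.length.add hu).add (.const 1))).add (.const 1))))).add
      ((PolyBounded.const 1).add (PolyBounded.length.mul (.const 2))))
  · intro x
    have h1 := Run.loop (k := .inp) (p := .seq (emitArcs (l false)) (.push .idx true))
      (q := .seq (emitArcs (l true)) (.push .idx true))
      (c := (κ + κ') * (x.length + u x + 1) + 1) x
      (fun i => mk (x.drop i) ((inputArcs l (u x) 0 (x.take i)).flatMap encArc ++ out x) []
        (unary i) (len x) (unary (u x)) (cnt x) (aux x)) (by simp) (by
        intro i hi
        have ht : inputArcs l (u x) 0 (x.take (i + 1)) =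
            Affine.arcs (l x[i]) i (u x) ++ inputArcs l (u x) 0 (x.take i) := by
          rw [List.take_add_one, List.getElem?_eq_getElem hi, inputArcs_append]
          simp [inputArcs, Nat.min_eq_left hi.le]
        rw [ht]
        cases x[i] with
        | false =>
          refine (((h i (u x) (x.drop (i + 1)) _ _ _ _).seq (Run.push .idx true _)).congr
            (update_inp ..).symm ?_).mono ?_
          · simp
          · gcongr
            omega
        | true =>
          refine (((h' i (u x) (x.drop (i + 1)) _ _ _ _).seq (Run.push .idx true _)).congr
            (update_inp ..).symm ?_).mono ?_
          · simp
          · gcongr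
            omega)
    refine ((h1.seq (run_clear .idx _)).congr ?_ ?_).mono ?_ <;> simp [inputArcs]

/-! #### Evaluation of polynomials -/

/-- Replace the number `m` on the stack `cnt` by `m * n + a`, where `n` is on the stack `len`. -/
def hornerStep (a : ℕ) : Prog Reg :=
  .seq (each .cnt (.push .aux true)) (.seq (each .aux (addReg .len .cnt)) (pushes .cnt (unary a)))

def horner : List ℕ → Prog Reg
  | [] => .skip
  | a :: l => .seq (horner l) (hornerStep a)

def hornerEval (l : List ℕ) (n : ℕ) : ℕ := l.foldr (fun a m => m * n + a) 0

theorem polyBounded_hornerEval : ∀ l : List ℕ, PolyBounded fun x => hornerEval l x.length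
  | [] => .const 0
  | a :: l => ((polyBounded_hornerEval l).mul .length).add (.const a)

/-- Coefficient lists are closed under adding a constant and under multiplication by the variable,
which are the two steps of Horner induction. -/
theorem exists_hornerEval (P : Polynomial ℕ) : ∃ l : List ℕ, ∀ n, hornerEval l n = P.eval n := by
  induction P using Polynomial.recOnHorner with
  | M0 => exact ⟨[], by simp [hornerEval]⟩
  | MC p a _ _ ih =>
    obtain ⟨l, hl⟩ := ih
    cases l with
    | nil => exact ⟨[a], fun n => by simp [← hl n, hornerEval]⟩
    | cons b l => exact ⟨(b + a) :: l, fun n => by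
        simp [← hl n, hornerEval, ← Nat.add_assoc]⟩
  | MX p _ ih =>
    obtain ⟨l, hl⟩ := ih
    exact ⟨0 :: l, fun n => by simp [← hl n, hornerEval]⟩

/-- The old value `m` is moved to `aux`, and each of its letters then adds a copy of `len` to `cnt`;
the constant `a` is known to the program and is pushed directly. -/
theorem run_hornerStep (a m n : ℕ) (inp out idx base : List Bool) :
    Run (hornerStep a) (mk inp out [] idx (unary n) base (unary m) [])
      (mk inp out [] idx (unary n) base (unary (m * n + a)) [])
      ((1 + m * 2) + ((1 + m * (1 + (2 + 5 * n))) + (a + 1))) := by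
  have h1 := Run.each (k := .cnt) (p := .push .aux true) (c := 1) (unary m)
    (fun i => mk inp out [] idx (unary n) base (unary (m - i)) (unary i)) (by simp) (by
      intro i hi
      refine (Run.push _ _ _).congr rfl ?_
      simp)
  have h2 := Run.each (k := .aux) (p := addReg .len .cnt) (c := 2 + 5 * n) (unary m)
    (fun i => mk inp out [] idx (unary n) base (unary (i * n)) (unary (m - i))) (by simp) (by
      intro i hi
      exact (run_addReg (by decide) (by decide) (by decide) _ rfl rfl).congr (by simp; rfl)
        (by simp [Nat.succ_mul, Nat.add_comm]))
  simp only [length_unary, Nat.sub_self, Nat.sub_zero, Nat.zero_mul] at h1 h2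
  refine ((h1.seq (h2.seq (run_pushes .cnt _ (unary a)))).congr rfl ?_).mono ?_ <;>
    simp [Nat.add_comm]

theorem polyRun_horner (inp out idx base : List Bool → List Bool) : ∀ l : List ℕ,
    PolyRun (horner l)
      (fun x => mk (inp x) (out x) [] (idx x) (unary x.length) (base x) [] [])
      (fun x => mk (inp x) (out x) [] (idx x) (unary x.length) (base x)
        (unary (hornerEval l x.length)) [])
  | [] => .of_run (.const 1) fun _ => Run.skip _
  | a :: l => (polyRun_horner inp out idx base l).seq (.of_run
      (((PolyBounded.const 1).add ((polyBounded_hornerEval l).mul (.const 2))).add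
        (((PolyBounded.const 1).add ((polyBounded_hornerEval l).mul ((PolyBounded.const 1).add
        ((PolyBounded.const 2).add ((PolyBounded.const 5).mul .length))))).add (.const (a + 1))))
      fun _ => run_hornerStep a _ _ _ _ _ _)

end StackProg

/-! ### Networks in which the slaves remember what the master has written -/

namespace NonAtomic

open StackProg

def Action.Bounded (M : ℕ) : Action ℕ → Prop
  | .silent => True
  | .read g => g ≤ M
  | .write g => g ≤ M

/-- The states of the arc are at most `C`, and the values in its label are at most `M`. -/
def Arc.Bounded (C M : ℕ) (r : Arc ℕ ℕ) : Prop :=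
  r.source ≤ C ∧ r.label.Bounded M ∧ r.target ≤ C

def Arc.toRule (C M : ℕ) (r : Arc ℕ ℕ) : Rule (Fin (C + 1)) (Fin 1) (Fin (M + 1)) :=
  ⟨Fin.ofNat (C + 1) r.source, 0, r.label.map (Fin.ofNat (M + 1)), Fin.ofNat (C + 1) r.target, [0]⟩

/-- The system without stack with states `0, …, C` and the given arcs. -/
def ofArcs (M C init : ℕ) (l : List (Arc ℕ ℕ)) : NaPDS (Fin (M + 1)) where
  numControls := C + 1
  numSymbols := 0
  init := Fin.ofNat (C + 1) init
  rules := l.map (Arc.toRule C M)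
  preservesBottom r hr := by
    obtain ⟨r, -, rfl⟩ := List.mem_map.1 hr
    exact ⟨fun h => absurd rfl h, fun _ => ⟨[], by simp, rfl⟩⟩

theorem stackless_ofArcs (M C init : ℕ) (l : List (Arc ℕ ℕ)) : (ofArcs M C init l).Stackless := by
  refine ⟨rfl, fun r hr => ?_⟩
  obtain ⟨r, -, rfl⟩ := List.mem_map.1 hr
  rfl

/-- A slave in state `0` can learn the value of the store, and then write it again. -/
def slaveTemplates : List (Arc Affine Affine) :=
  [⟨⟨0, 0, 0⟩, .read ⟨1, 0, 0⟩, ⟨1, 0, 0⟩⟩, ⟨⟨1, 0, 0⟩, .write ⟨1, 0, 0⟩, ⟨1, 0, 0⟩⟩]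

def slaveArcs (M : ℕ) : List (Arc ℕ ℕ) := forArcs slaveTemplates (M + 1) 0

/-- For `f = 0` the second kind of rule lets a slave that has learned nothing write `0`. This is
harmless since `0` is the initial store value and thus always known. -/
theorem mem_slaveArcs {M : ℕ} {r : Arc ℕ ℕ} :
    r ∈ slaveArcs M ↔ ∃ f ≤ M, r = ⟨0, .read f, f⟩ ∨ r = ⟨f, .write f, f⟩ := by
  simp [slaveArcs, forArcs, slaveTemplates, Affine.arcs, Affine.arc, Arc.map, Action.map,
    Affine.eval]

/-- The instance with the given master and slaves that remember one value; the master has to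
reach the state `0`. -/
def memoryInstance (M C init : ℕ) (l : List (Arc ℕ ℕ)) : Instance where
  numValues := M + 1
  master := ofArcs M C init l
  slave := ofArcs M M 0 (slaveArcs M)
  initStore := 0
  goal := .inl (0 : Fin (C + 1))

theorem stackless_memoryInstance (M C init : ℕ) (l : List (Arc ℕ ℕ)) :
    (memoryInstance M C init l).Stackless :=
  ⟨stackless_ofArcs .., stackless_ofArcs ..⟩

/-! #### The code of the instance -/

theorem val_ofNat {n a : ℕ} (h : a ≤ n) : (Fin.ofNat (n + 1) a).val = a :=
  Nat.mod_eq_of_lt (Nat.lt_succ_of_le h)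

theorem encFin_ofNat {n a : ℕ} (h : a ≤ n) : encFin (Fin.ofNat (n + 1) a) = encNat a := by
  rw [encFin, val_ofNat h]

theorem encList_eq {α : Type} (f : α → List Bool) :
    ∀ l : List α, encList f l = (l.flatMap fun a => true :: f a) ++ [false]
  | [] => rfl
  | a :: l => by simp [encList, encList_eq f l]

theorem encRule_toRule {C M : ℕ} {r : Arc ℕ ℕ} (h : r.Bounded C M) :
    true :: encRule (r.toRule C M) = encArc r := by
  obtain ⟨s, a, t⟩ := r
  obtain ⟨h1, h2, h3⟩ := h
  have e : encRule (Arc.toRule C M ⟨s, a, t⟩) = encNat s ++ [false] ++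
      encAction (a.map (Fin.ofNat (M + 1))) ++ encNat t ++ [true, false, false] := by
    rw [← encFin_ofNat h1, ← encFin_ofNat h3]
    rfl
  rw [e, encArc]
  cases a with
  | silent => rfl
  | read g =>
    rw [encActionNat, ← encFin_ofNat (show g ≤ M from h2)]
    rfl
  | write g =>
    rw [encActionNat, ← encFin_ofNat (show g ≤ M from h2)]
    rfl

def encArcs (C init : ℕ) (l : List (Arc ℕ ℕ)) : List Bool :=
  encNat (C + 1) ++ ([false] ++ (encNat init ++ (l.flatMap encArc ++ [false])))

theorem encNaPDS_ofArcs {M C init : ℕ} {l : List (Arc ℕ ℕ)} (hi : init ≤ C)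
    (hl : ∀ r ∈ l, r.Bounded C M) : encNaPDS (ofArcs M C init l) = encArcs C init l := by
  have h : ((l.map (Arc.toRule C M)).flatMap fun a => true :: encRule a) = l.flatMap encArc := by
    rw [List.flatMap_map]
    exact List.flatMap_congr fun r hr => encRule_toRule (hl r hr)
  unfold encNaPDS encArcs
  change encNat (C + 1) ++ encNat 0 ++ encFin (Fin.ofNat (C + 1) init) ++
    encList encRule (l.map (Arc.toRule C M)) = _
  rw [encFin_ofNat hi, encList_eq, h]
  simp [encNat]

theorem bounded_slaveArcs (M : ℕ) : ∀ r ∈ slaveArcs M, r.Bounded M M := by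
  intro r hr
  obtain ⟨f, hf, rfl | rfl⟩ := mem_slaveArcs.1 hr
  · exact ⟨Nat.zero_le _, hf, hf⟩
  · exact ⟨hf, hf, hf⟩

theorem encInstance_memoryInstance {M C init : ℕ} {l : List (Arc ℕ ℕ)} (hi : init ≤ C)
    (hl : ∀ r ∈ l, r.Bounded C M) :
    encInstance (memoryInstance M C init l) =
      encNat (M + 1) ++ (encArcs C init l ++ (encArcs M 0 (slaveArcs M) ++
        [false, false, false])) := by
  unfold encInstance
  change encNat (M + 1) ++ encNaPDS (ofArcs M C init l) ++ encNaPDS (ofArcs M M 0 (slaveArcs M)) ++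
    [false] ++ [false, false] = _
  rw [encNaPDS_ofArcs hi hl, encNaPDS_ofArcs (Nat.zero_le _) (bounded_slaveArcs M)]
  simp

/-! #### Runs of the master with a growing set of facts -/

/-- A step of the master: writing a value makes it available for ever. -/
inductive FactStep {Q Φ : Type} (l : List (Arc Q Φ)) : Q × Set Φ → Q × Set Φ → Prop
  | silent {s t : Q} (F : Set Φ) : ⟨s, .silent, t⟩ ∈ l → FactStep l (s, F) (t, F)
  | read {s t : Q} {F : Set Φ} {φ : Φ} : ⟨s, .read φ, t⟩ ∈ l → φ ∈ F → FactStep l (s, F) (t, F)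
  | write {s t : Q} (F : Set Φ) {φ : Φ} :
      ⟨s, .write φ, t⟩ ∈ l → FactStep l (s, F) (t, insert φ F)

def FactReach {Q Φ : Type} (l : List (Arc Q Φ)) : Q × Set Φ → Q × Set Φ → Prop :=
  Relation.ReflTransGen (FactStep l)

/-! ### Single transitions of the network -/

section Network

variable {M C init n : ℕ} {l : List (Arc ℕ ℕ)}

/-- The processes of the instance `memoryInstance M C init l`. -/
abbrev memoryNetwork (M C init : ℕ) (l : List (Arc ℕ ℕ)) (n : ℕ) :
    Option (Fin n) → NaPDS (Fin (M + 1)) :=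
  masterSlaves (ofArcs M C init l) (ofArcs M M 0 (slaveArcs M)) n

/-- The configuration with the given state of the master, states of the slaves and store. -/
def net (s : Fin (C + 1)) (σ : Fin n → Fin (M + 1)) (v : Fin (M + 1)) :
    Config (memoryNetwork M C init l n) where
  local_
    | none => ((s, [0]) : Fin (C + 1) × List (Fin 1))
    | some i => ((σ i, [0]) : Fin (M + 1) × List (Fin 1))
  store := v

theorem localStep_ofArcs_iff {s : Fin (C + 1)} {a : Action (Fin (M + 1))}
    {c' : Fin (C + 1) × List (Fin 1)} : (ofArcs M C init l).LocalStep (s, [0]) a c' ↔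
    ∃ r ∈ l, s = Fin.ofNat (C + 1) r.source ∧ a = r.label.map (Fin.ofNat (M + 1)) ∧
      c' = (Fin.ofNat (C + 1) r.target, [0]) := by
  constructor
  · rintro ⟨r, hr, rfl, u, h1, h2⟩
    obtain ⟨r, hr', rfl⟩ := List.mem_map.1 hr
    have e1 : s = Fin.ofNat (C + 1) r.source := congrArg Prod.fst h1
    have e2 : [0] = (0 : Fin 1) :: u := congrArg Prod.snd h1
    obtain rfl : [] = u := (List.cons.inj e2).2
    exact ⟨r, hr', e1, rfl, h2⟩
  · rintro ⟨r, hr, rfl, rfl, rfl⟩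
    exact ⟨r.toRule C M, List.mem_map_of_mem hr, rfl, [], rfl, rfl⟩

theorem config_ext {c : Config (memoryNetwork M C init l n)} {s : Fin (C + 1)}
    {σ : Fin n → Fin (M + 1)} {v : Fin (M + 1)}
    (h : c.local_ none = ((s, [0]) : Fin (C + 1) × List (Fin 1)))
    (h' : ∀ i, c.local_ (some i) = ((σ i, [0]) : Fin (M + 1) × List (Fin 1)))
    (hv : c.store = v) : c = net s σ v := by
  obtain ⟨L, w⟩ := c
  have : L = (net s σ v : Config (memoryNetwork M C init l n)).local_ := by
    funext i
    cases i with
    | none => exact h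
    | some i => exact h' i
  obtain rfl : w = v := hv
  rw [this]
  rfl

theorem step_net_master (σ : Fin n → Fin (M + 1)) {v v' : Fin (M + 1)} {r : Arc ℕ ℕ} (hr : r ∈ l)
    (hv : storeEffect (r.label.map (Fin.ofNat (M + 1))) v v') :
    Step (memoryNetwork M C init l n) (net (Fin.ofNat (C + 1) r.source) σ v)
      (net (Fin.ofNat (C + 1) r.target) σ v') := by
  refine ⟨none, _, localStep_ofArcs_iff.2 ⟨r, hr, rfl, rfl, rfl⟩, ?_, hv⟩
  rintro (_ | i) h
  · exact absurd rfl h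
  · rfl

theorem step_net_slave (s : Fin (C + 1)) (σ : Fin n → Fin (M + 1)) {v v' : Fin (M + 1)}
    {r : Arc ℕ ℕ} (hr : r ∈ slaveArcs M) (i : Fin n) (hi : σ i = Fin.ofNat (M + 1) r.source)
    (hv : storeEffect (r.label.map (Fin.ofNat (M + 1))) v v') :
    Step (memoryNetwork M C init l n) (net s σ v)
      (net s (Function.update σ i (Fin.ofNat (M + 1) r.target)) v') := by
  refine ⟨some i, _, localStep_ofArcs_iff.2 ⟨r, hr, hi, rfl, ?_⟩, ?_, hv⟩
  · simp [net]
  · rintro (_ | j) h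
    · rfl
    · have : j ≠ i := fun e => h (congrArg some e)
      change ((Function.update σ i _ j, [0]) : Fin (M + 1) × List (Fin 1)) = (σ j, [0])
      rw [Function.update_of_ne this]

theorem step_net {s : Fin (C + 1)} {σ : Fin n → Fin (M + 1)} {v : Fin (M + 1)}
    {c' : Config (memoryNetwork M C init l n)}
    (h : Step (memoryNetwork M C init l n) (net s σ v) c') :
    (∃ r ∈ l, s = Fin.ofNat (C + 1) r.source ∧ ∃ v', c' = net (Fin.ofNat (C + 1) r.target) σ v' ∧
      storeEffect (r.label.map (Fin.ofNat (M + 1))) v v') ∨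
    ∃ i, ∃ r ∈ slaveArcs M, σ i = Fin.ofNat (M + 1) r.source ∧ ∃ v',
      c' = net s (Function.update σ i (Fin.ofNat (M + 1) r.target)) v' ∧
      storeEffect (r.label.map (Fin.ofNat (M + 1))) v v' := by
  obtain ⟨_ | i, a, h1, h2, h3⟩ := h
  · obtain ⟨r, hr, hs, rfl, hc⟩ := localStep_ofArcs_iff.1 h1
    exact .inl ⟨r, hr, hs, c'.store, config_ext hc (fun i => h2 (some i) (by simp)) rfl, h3⟩
  · obtain ⟨r, hr, hs, rfl, hc⟩ := localStep_ofArcs_iff.1 h1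
    refine .inr ⟨i, r, hr, hs, c'.store, config_ext (h2 none (by simp)) (fun j => ?_) rfl, h3⟩
    by_cases hj : j = i
    · subst hj
      rw [Function.update_self]
      exact hc
    · rw [h2 (some j) (by simpa using hj), Function.update_of_ne hj]
      rfl

end Network

/-! ### Equivalence of the network with a master that accumulates facts -/

section Reach

variable {Q Φ : Type} {cq : Q → ℕ} {cf : Φ → ℕ} {l : List (Arc Q Φ)} {M C : ℕ}

/-- The facts of all values in the network are known to the master. -/
def Known (cf : Φ → ℕ) (F : Set Φ) (v : Fin (M + 1)) : Prop := ∃ φ ∈ F, v.val = cf φ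

theorem Known.mono {F F' : Set Φ} (h : F ⊆ F') {v : Fin (M + 1)} (hv : Known cf F v) :
    Known cf F' v :=
  let ⟨φ, hφ, e⟩ := hv
  ⟨φ, h hφ, e⟩

/-- Soundness of the memory, for any number of slaves: the store and all slave states only ever hold
codes of facts that the master has written or of the initial fact. Thus a value read by the master
is a known fact, and moves of slaves can be dropped from the run. -/
theorem factReach_of_network (hq : Function.Injective cq) (hf : Function.Injective cf) {q₀ : Q}
    {φ₀ : Φ} (h₀ : cf φ₀ = 0) (hq₀ : cq q₀ ≤ C) (hl : ∀ r ∈ l, (r.map cq cf).Bounded C M) {n : ℕ}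
    {c : Config (memoryNetwork M C (cq q₀) (l.map (Arc.map cq cf)) n)}
    (h : HasRunTo (memoryNetwork M C (cq q₀) (l.map (Arc.map cq cf)) n) 0 c) :
    ∃ s σ v q F, c = net s σ v ∧ FactReach l (q₀, {φ₀}) (q, F) ∧ s.val = cq q ∧
      φ₀ ∈ F ∧ Known cf F v ∧ ∀ i, Known cf F (σ i) := by
  induction h with
  | refl =>
    -- The store and all slaves start at `0`, which is the code of the initial fact.
    refine ⟨Fin.ofNat (C + 1) (cq q₀), fun _ => 0, 0, q₀, {φ₀},
      config_ext rfl (fun i => rfl) rfl, .refl, val_ofNat hq₀, rfl, ⟨φ₀, rfl, h₀.symm⟩,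
      fun i => ⟨φ₀, rfl, h₀.symm⟩⟩
  | tail _ hstep ih =>
    obtain ⟨s, σ, v, q, F, rfl, hr, hs, hφ₀, hv, hσ⟩ := ih
    rcases step_net hstep with ⟨r', hr', e, v', rfl, hv'⟩ | ⟨i, r, hr', e, v', rfl, hv'⟩
    · obtain ⟨r, hrl, rfl⟩ := List.mem_map.1 hr'
      obtain ⟨b1, b2, b3⟩ := hl r hrl
      obtain ⟨s', a, t⟩ := r
      obtain rfl : s' = q := hq (by rw [← hs, e]; exact (val_ofNat b1).symm)
      cases a with
      | silent =>
        obtain rfl : v' = v := hv'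
        exact ⟨_, σ, v', t, F, rfl, hr.tail (.silent F hrl), val_ofNat b3, hφ₀, hv, hσ⟩
      | read φ =>
        obtain ⟨h1, rfl⟩ : Fin.ofNat (M + 1) (cf φ) = v ∧ v' = v := hv'
        obtain ⟨ψ, hψ, hvψ⟩ := hv
        obtain rfl : φ = ψ := hf (by rw [← hvψ, ← h1]; exact (val_ofNat b2).symm)
        exact ⟨_, σ, v', t, F, rfl, hr.tail (.read hrl hψ), val_ofNat b3, hφ₀, ⟨φ, hψ, hvψ⟩, hσ⟩
      | write φ =>
        obtain rfl : v' = Fin.ofNat (M + 1) (cf φ) := hv'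
        exact ⟨_, σ, _, t, insert φ F, rfl, hr.tail (.write F hrl), val_ofNat b3, .inr hφ₀,
          ⟨φ, .inl rfl, val_ofNat b2⟩, fun i => (hσ i).mono (Set.subset_insert φ F)⟩
    -- A move of a slave corresponds to no step of the master; only the knowledge about the store
    -- and the slave states has to be checked.
    · refine ⟨s, _, v', q, F, rfl, hr, hs, hφ₀, ?_⟩
      obtain ⟨f, hfM, rfl | rfl⟩ := mem_slaveArcs.1 hr'
      · obtain ⟨h1, rfl⟩ : Fin.ofNat (M + 1) f = v ∧ v' = v := hv'
        refine ⟨hv, fun j => ?_⟩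
        by_cases hj : j = i
        · subst hj
          rw [Function.update_self]
          exact h1 ▸ hv
        · rw [Function.update_of_ne hj]
          exact hσ j
      · obtain rfl : v' = Fin.ofNat (M + 1) f := hv'
        have hk : Known cf F (Fin.ofNat (M + 1) f) := e ▸ hσ i
        refine ⟨hk, fun j => ?_⟩
        by_cases hj : j = i
        · subst hj
          rw [Function.update_self]
          exact hk
        · rw [Function.update_of_ne hj]
          exact hσ j

/-- Completeness of the memory: slave `i` is reserved for the value `i`. It copies the value right
after the master writes it and puts it back right before the master reads it. -/
theorem network_of_factReach {q₀ q : Q} {φ₀ : Φ} {F : Set Φ} (h₀ : cf φ₀ = 0)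
    (hl : ∀ r ∈ l, (r.map cq cf).Bounded C M) (h : FactReach l (q₀, {φ₀}) (q, F)) :
    ∃ (σ : Fin (M + 1) → Fin (M + 1)) (v : Fin (M + 1)),
      HasRunTo (memoryNetwork M C (cq q₀) (l.map (Arc.map cq cf)) (M + 1)) 0
        (net (Fin.ofNat (C + 1) (cq q)) σ v) ∧
      (∀ i, σ i = 0 ∨ σ i = i) ∧
      ∀ φ ∈ F, σ (Fin.ofNat (M + 1) (cf φ)) = Fin.ofNat (M + 1) (cf φ) := by
  generalize hc : (q, F) = c at h
  induction h generalizing q F with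
  | refl =>
    obtain ⟨rfl, rfl⟩ := Prod.mk.inj hc
    refine ⟨fun _ => 0, 0, ?_, fun i => .inl rfl, ?_⟩
    · have h : initialConfig (memoryNetwork M C (cq q) (l.map (Arc.map cq cf)) (M + 1)) 0 =
          net (Fin.ofNat (C + 1) (cq q)) (fun _ => 0) 0 := config_ext rfl (fun i => rfl) rfl
      exact h ▸ .refl
    · rintro φ rfl
      rw [h₀]
      rfl
  | tail _ hstep ih =>
    subst hc
    cases hstep with
    | @silent s _ _ hrl =>
      obtain ⟨σ, v, hrun, hσ, hF⟩ := ih rfl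
      exact ⟨σ, v, hrun.tail (step_net_master σ (List.mem_map_of_mem hrl) rfl), hσ, hF⟩
    | @read s _ _ φ hrl hφ =>
      obtain ⟨σ, v, hrun, hσ, hF⟩ := ih rfl
      have hb := (hl _ hrl).2.1
      -- Before the master reads, the slave reserved for this value puts it into the store. It stays
      -- in its state, so `σ` is unchanged.
      have h1 := step_net_slave (C := C) (init := cq q₀) (l := l.map (Arc.map cq cf)) (v := v)
        (v' := Fin.ofNat (M + 1) (cf φ))
        (Fin.ofNat (C + 1) (cq s)) σ (mem_slaveArcs.2 ⟨cf φ, hb, .inr rfl⟩) _ (hF φ hφ) rfl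
      have h2 : Function.update σ (Fin.ofNat (M + 1) (cf φ)) (Fin.ofNat (M + 1) (cf φ)) = σ :=
        Function.update_eq_self_iff.2 (hF φ hφ).symm
      rw [h2] at h1
      exact ⟨σ, _, (hrun.tail h1).tail (step_net_master σ (List.mem_map_of_mem hrl) ⟨rfl, rfl⟩),
        hσ, hF⟩
    | @write s _ F φ hrl =>
      obtain ⟨σ, v, hrun, hσ, hF⟩ := ih rfl
      have hb := (hl _ hrl).2.1
      set i := Fin.ofNat (M + 1) (cf φ) with hi
      have h1 := hrun.tail (step_net_master (v := v) (v' := i) σ (List.mem_map_of_mem hrl) rfl)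
      -- Either the reserved slave is still in state `0` and copies the value now, or it already
      -- holds it and no move is needed.
      rcases hσ i with h0 | h0
      · refine ⟨_, _, h1.tail (step_net_slave _ σ (mem_slaveArcs.2 ⟨cf φ, hb, .inl rfl⟩) i h0
          ⟨rfl, rfl⟩), fun j => ?_, ?_⟩
        · by_cases hj : j = i
          · subst hj
            exact .inr (Function.update_self ..)
          · rw [Function.update_of_ne hj]
            exact hσ j
        · intro ψ hψ
          by_cases hj : Fin.ofNat (M + 1) (cf ψ) = i
          · rw [hj]
            exact Function.update_self ..
          · rw [Function.update_of_ne hj]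
            rcases hψ with rfl | hψ
            · exact absurd rfl hj
            · exact hF ψ hψ
      · refine ⟨σ, i, h1, hσ, ?_⟩
        rintro ψ (rfl | hψ)
        · exact h0
        · exact hF ψ hψ

/-- The network reaches its goal if and only if the master does so when every value that has been
written can be read for ever. -/
theorem reachable_memoryInstance_iff (hq : Function.Injective cq) (hf : Function.Injective cf)
    {q₀ q₁ : Q} {φ₀ : Φ} (h₀ : cf φ₀ = 0) (h₁ : cq q₁ = 0) (hq₀ : cq q₀ ≤ C)
    (hl : ∀ r ∈ l, (r.map cq cf).Bounded C M) :
    (memoryInstance M C (cq q₀) (l.map (Arc.map cq cf))).Reachable ↔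
      ∃ F, FactReach l (q₀, {φ₀}) (q₁, F) := by
  constructor
  · rintro ⟨n, c, hrun, hc⟩
    obtain ⟨s, σ, v, q, F, rfl, hr, hs, -⟩ := factReach_of_network hq hf h₀ hq₀ hl hrun
    obtain rfl : q = q₁ := hq (by
      rw [← hs, h₁]
      exact congrArg Fin.val (show s = 0 from hc))
    exact ⟨F, hr⟩
  · rintro ⟨F, hF⟩
    obtain ⟨σ, v, hrun, -⟩ := network_of_factReach h₀ hl hF
    refine ⟨M + 1, _, hrun, ?_⟩
    change Fin.ofNat (C + 1) (cq q₁) = 0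
    rw [h₁]
    rfl

end Reach

end NonAtomic

namespace StackProg

open Function NonAtomic

/-! #### The generator of instances -/

/-- A store depending on the input word `x`, with the length of `x` on the stack `len`. -/
def genStore (inp out base cnt : List Bool → List Bool) (x : List Bool) : Store Reg :=
  mk (inp x) (out x) [] [] (unary x.length) (base x) (cnt x) []

section Blocks

variable (inp out base : List Bool → List Bool)

/-- The length is needed while the input must survive, so the input is moved to `aux` and back. Two
reversals restore its order. -/
def loadInput : Prog Reg :=
  .seq (.loop .inp (.seq (.push .aux false) (.push .len true))
    (.seq (.push .aux true) (.push .len true))) (.loop .aux (.push .inp false) (.push .inp true))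

theorem polyRun_loadInput :
    PolyRun loadInput (single .inp) (genStore id (fun _ => []) (fun _ => []) (fun _ => [])) := by
  refine .of_run (f := fun x => (1 + x.length * (1 + 2)) + (1 + x.length * (1 + 1)))
    (((PolyBounded.const 1).add (PolyBounded.length.mul (.const 3))).add
      ((PolyBounded.const 1).add (PolyBounded.length.mul (.const 2)))) fun x => ?_
  have h1 := Run.loop (k := .inp) (p := .seq (.push .aux false) (.push .len true))
    (q := .seq (.push .aux true) (.push .len true)) (c := 2) x
    (fun i => mk (x.drop i) [] [] [] (unary i) [] [] (x.take i).reverse) (by simp) (by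
      intro i hi
      cases hb : x[i] <;>
      · refine ((Run.push _ _ _).seq (Run.push _ _ _)).congr rfl ?_
        simp [List.take_add_one, List.getElem?_eq_getElem hi, hb])
  have h2 := Run.loop (k := .aux) (p := .push .inp false) (q := .push .inp true) (c := 1) x.reverse
    (fun i => mk (x.reverse.take i).reverse [] [] [] (unary x.length) [] [] (x.reverse.drop i))
    (by simp) (by
      intro i hi
      cases hb : x.reverse[i] <;>
      · refine (Run.push _ _ _).congr rfl ?_
        simp [List.take_add_one (l := x.reverse), List.getElem?_eq_getElem hi, hb])
  refine ((h1.congr ?_ ?_).seq h2).congr rfl ?_ |>.mono ?_ <;>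
    simp [single_inp, genStore, List.take_of_length_le, List.drop_of_length_le]

theorem polyRun_pushes (cnt : List Bool → List Bool) (w : List Bool) :
    PolyRun (pushes .out w) (genStore inp out base cnt)
      (genStore inp (fun x => w ++ out x) base cnt) :=
  .of_run (.const (w.length + 1)) fun _ => (run_pushes .out _ w).congr rfl (by simp [genStore])

def moveNat (k : Reg) : Prog Reg := each .cnt (.push k true)

def emitCnt : Prog Reg := .seq (pushes .out [false]) (moveNat .out)

theorem polyRun_emitCnt {v : List Bool → ℕ} (hv : PolyBounded v) :
    PolyRun emitCnt (genStore inp out base fun x => unary (v x))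
      (genStore inp (fun x => encNat (v x) ++ out x) base fun _ => []) := by
  refine (polyRun_pushes ..).seq (.of_run ((PolyBounded.const 1).add
    (hv.mul (.const 2))) fun x => ?_)
  have h1 := Run.each (k := .cnt) (p := .push .out true) (c := 1) (unary (v x))
    (fun i => mk (inp x) (unary i ++ ([false] ++ out x)) [] [] (unary x.length) (base x)
      (unary (v x - i)) []) (by simp) (by
      intro i hi
      refine (Run.push _ _ _).congr rfl ?_
      simp [cons_unary_append])
  refine (h1.congr ?_ ?_).mono ?_ <;> simp [genStore, encNat_eq]

theorem polyRun_moveBase {v : List Bool → ℕ} (hv : PolyBounded v) :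
    PolyRun (moveNat .base) (genStore inp out (fun _ => []) fun x => unary (v x))
      (genStore inp out (fun x => unary (v x)) fun _ => []) := by
  refine .of_run ((PolyBounded.const 1).add (hv.mul (.const 2))) fun x => ?_
  have h1 := Run.each (k := .cnt) (p := .push .base true) (c := 1) (unary (v x))
    (fun i => mk (inp x) (out x) [] [] (unary x.length) (unary i) (unary (v x - i)) [])
    (by simp) (by
      intro i hi
      refine (Run.push _ _ _).congr rfl ?_
      simp)
  refine (h1.congr ?_ ?_).mono ?_ <;> simp [genStore]

theorem polyRun_clearBase {v : List Bool → ℕ} (hv : PolyBounded v) :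
    PolyRun (clear .base) (genStore inp out (fun x => unary (v x)) fun _ => [])
      (genStore inp out (fun _ => []) fun _ => []) :=
  .of_run ((PolyBounded.const 1).add (hv.mul (.const 2))) fun _ =>
    ((run_clear .base _).congr rfl (by simp [genStore])).mono (by simp [genStore])

/-- Set the stack `base` to the value of a polynomial. -/
def setBase (l : List ℕ) : Prog Reg := .seq (horner l) (moveNat .base)

theorem polyRun_setBase (l : List ℕ) :
    PolyRun (setBase l) (genStore inp out (fun _ => []) fun _ => [])
      (genStore inp out (fun x => unary (hornerEval l x.length)) fun _ => []) :=
  (polyRun_horner inp out (fun _ => []) (fun _ => []) l).seq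
    (polyRun_moveBase inp out (polyBounded_hornerEval l))

/-- Emit the value of a polynomial. -/
def emitHorner (l : List ℕ) : Prog Reg := .seq (horner l) emitCnt

theorem polyRun_emitHorner (l : List ℕ) :
    PolyRun (emitHorner l) (genStore inp out base fun _ => [])
      (genStore inp (fun x => encNat (hornerEval l x.length) ++ out x) base fun _ => []) :=
  (polyRun_horner inp out (fun _ => []) base l).seq
    (polyRun_emitCnt inp out base (polyBounded_hornerEval l))

/-- A loop over the numbers below the value of a polynomial. -/
def forHorner (l : List ℕ) (T : List (Arc Affine Affine)) : Prog Reg := .seq (horner l) (forEmit T)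

theorem polyRun_forHorner (l : List ℕ) (T : List (Arc Affine Affine)) {u : List Bool → ℕ}
    (hu : PolyBounded u) :
    PolyRun (forHorner l T) (genStore inp out (fun x => unary (u x)) fun _ => [])
      (genStore inp (fun x => (forArcs T (hornerEval l x.length) (u x)).flatMap encArc ++ out x)
        (fun x => unary (u x)) fun _ => []) :=
  (polyRun_horner inp out (fun _ => []) _ l).seq
    (polyRun_forEmit T (polyBounded_hornerEval l) hu inp out _ _)

end Blocks

/-- The data of a generator: polynomials for the numbers of values and of states, and rule
templates for loops whose bounds and base numbers are polynomials in the length of the input. -/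
structure Generator where
  maxValue : List ℕ
  maxState : List ℕ
  init : ℕ
  inputRules : Bool → List (Arc Affine Affine)
  loops : List (List ℕ × List ℕ × List (Arc Affine Affine))

namespace Generator

def loopArcs (n : ℕ) (L : List ℕ × List ℕ × List (Arc Affine Affine)) : List (Arc ℕ ℕ) :=
  forArcs L.2.2 (hornerEval L.2.1 n) (hornerEval L.1 n)

def arcs (g : Generator) (x : List Bool) : List (Arc ℕ ℕ) :=
  inputArcs g.inputRules 0 0 x ++ g.loops.flatMap (loopArcs x.length)

def toInstance (g : Generator) (x : List Bool) : Instance :=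
  memoryInstance (hornerEval g.maxValue x.length) (hornerEval g.maxState x.length) g.init (g.arcs x)

def loopsProg : List (List ℕ × List ℕ × List (Arc Affine Affine)) → Prog Reg
  | [] => .skip
  | L :: l => .seq (loopsProg l)
      (.seq (setBase L.1) (.seq (forHorner L.2.1 L.2.2) (clear .base)))

theorem polyRun_loopsProg (inp out : List Bool → List Bool) :
    ∀ l, PolyRun (loopsProg l) (genStore inp out (fun _ => []) fun _ => [])
      (genStore inp (fun x => (l.flatMap (loopArcs x.length)).flatMap encArc ++ out x) (fun _ => [])
        fun _ => [])
  | [] => .of_run (.const 1) fun _ => Run.skip _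
  | L :: l => ((polyRun_loopsProg inp out l).seq ((polyRun_setBase ..).seq
      ((polyRun_forHorner _ _ _ _ (polyBounded_hornerEval L.1)).seq
        (polyRun_clearBase _ _ (polyBounded_hornerEval L.1))))).congr fun x => by
      simp [genStore, loopArcs]

/-- Increase the value of a polynomial by one. -/
def succCoeff : List ℕ → List ℕ
  | [] => [1]
  | a :: l => (a + 1) :: l

theorem hornerEval_succCoeff (l : List ℕ) (n : ℕ) :
    hornerEval (succCoeff l) n = hornerEval l n + 1 := by
  cases l <;> simp [hornerEval, succCoeff, Nat.add_assoc]

/-- The code of the instance is produced from its end. The four letters `false` pushed first are the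
goal (two letters), the initial store value and the end of the rule list of the slave; the next two
are the initial state and the symbol count of the slave. The input is consumed by `forInput`; all
other blocks need only its length, which is kept on `len` and cleared at the end. -/
def prog (g : Generator) : Prog Reg :=
  .seq loadInput (.seq (pushes .out [false, false, false, false])
  (.seq (forHorner (succCoeff g.maxValue) slaveTemplates) (.seq (pushes .out [false, false])
  (.seq (emitHorner (succCoeff g.maxValue)) (.seq (pushes .out [false])
  (.seq (loopsProg g.loops) (.seq (forInput g.inputRules) (.seq (pushes .out (encNat g.init))
  (.seq (pushes .out [false]) (.seq (emitHorner (succCoeff g.maxState))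
  (.seq (emitHorner (succCoeff g.maxValue)) (clear .len))))))))))))

theorem polyRun_prog (g : Generator) (hi : ∀ n, g.init ≤ hornerEval g.maxState n)
    (hb : ∀ x : List Bool, ∀ r ∈ g.arcs x,
      r.Bounded (hornerEval g.maxState x.length) (hornerEval g.maxValue x.length)) :
    PolyRun g.prog (single .inp) (fun x => single .out (encInstance (g.toInstance x))) := by
  have h := (polyRun_loadInput).seq <| (polyRun_pushes _ _ _ _ [false, false, false, false]).seq <|
    (polyRun_forHorner _ _ (succCoeff g.maxValue) slaveTemplates (.const 0)).seq <|
    (polyRun_pushes _ _ _ _ [false, false]).seq <|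
    (polyRun_emitHorner _ _ _ (succCoeff g.maxValue)).seq <|
    (polyRun_pushes _ _ _ _ [false]).seq <|
    (polyRun_loopsProg _ _ g.loops).seq <|
    (polyRun_forInput g.inputRules (.const 0) _ (fun x => unary x.length) (fun _ => [])
      (fun _ => [])).seq <|
    (polyRun_pushes (fun _ => []) _ (fun _ => []) (fun _ => []) (encNat g.init)).seq <|
    (polyRun_pushes _ _ _ _ [false]).seq <|
    (polyRun_emitHorner _ _ _ (succCoeff g.maxState)).seq <|
    (polyRun_emitHorner _ _ _ (succCoeff g.maxValue)).seq <|
    (PolyRun.of_run ((PolyBounded.const 1).add (PolyBounded.length.mul (.const 2)))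
      fun x => (run_clear .len _).mono (by simp [genStore]))
  refine h.congr fun x => ?_
  rw [toInstance, encInstance_memoryInstance (hi _) (hb x), single_out]
  simp [genStore, hornerEval_succCoeff, encArcs, slaveArcs, arcs, encNat]

end Generator

end StackProg

namespace NonAtomic

open StackProg

theorem nonempty_polyTime_toInstance (g : Generator) (hi : ∀ n, g.init ≤ hornerEval g.maxState n)
    (hb : ∀ x : List Bool, ∀ r ∈ g.arcs x,
      r.Bounded (hornerEval g.maxState x.length) (hornerEval g.maxValue x.length)) :
    Nonempty (Turing.TM2ComputableInPolyTime (Computability.encodingList Bool).encode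
      encInstance g.toInstance) :=
  let ⟨P, hP⟩ := g.polyRun_prog hi hb
  polyTime_of_run g.prog .inp .out encInstance g.toInstance P hP

end NonAtomic

/-! ### Stack machines as transducers acting on a queue -/

namespace StackMachine

open Function

variable {K G Q : Type}

/-- The instructions of a stack machine; the control state determines the instruction. -/
inductive Instr (K G Q : Type) where
  | push (k : K) (g : G) (q : Q)
  | pop (k : K) (f : Option G → Q)
  | peek (k : K) (f : Option G → Q)
  | halt (k : K) (accept : Option G → Prop)

variable [DecidableEq K]

def step (M : Q → Instr K G Q) (c : Q × (K → List G)) : Option (Q × (K → List G)) :=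
  match M c.1 with
  | .push k g q => some (q, update c.2 k (g :: c.2 k))
  | .pop k f => some (f (c.2 k).head?, update c.2 k (c.2 k).tail)
  | .peek k f => some (f (c.2 k).head?, c.2)
  | .halt _ _ => none

def Accepting (M : Q → Instr K G Q) (c : Q × (K → List G)) : Prop :=
  ∃ k f, M c.1 = .halt k f ∧ f (c.2 k).head?

/-- What a sweep over a row does: nothing, or shift track `k` down or up. The symbol is the one
just read, respectively the one expected next. -/
inductive Op (K G : Type) where
  | keep
  | push (k : K) (e : Option G)
  | pop (k : K) (e : Option G)

inductive Sweep : Op K G → (K → Option G) → (K → Option G) → Op K G → Prop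
  | keep (v : K → Option G) : Sweep .keep v v .keep
  | push (k : K) (e : Option G) (v : K → Option G) :
      Sweep (.push k e) v (update v k e) (.push k (v k))
  | pop (k : K) (v : K → Option G) (e : Option G) :
      Sweep (.pop k (v k)) v (update v k e) (.pop k e)

/-- The sweep may end here. -/
def Op.Done : Op K G → Prop
  | .keep => True
  | .push _ e => e = none
  | .pop _ e => e = none

inductive SweepRow : Op K G → List (K → Option G) → List (K → Option G) → Op K G → Prop
  | nil (o : Op K G) : SweepRow o [] [] o
  | cons {o o' o'' : Op K G} {v v' : K → Option G} {l l' : List (K → Option G)} :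
      Sweep o v v' o' → SweepRow o' l l' o'' → SweepRow o (v :: l) (v' :: l') o''

/-- The track of stack `k` in a row. -/
def track (k : K) (l : List (K → Option G)) : List (Option G) := l.map fun v => v k

omit [DecidableEq K] in
@[simp] theorem track_nil (k : K) : track k ([] : List (K → Option G)) = [] := rfl

omit [DecidableEq K] in
@[simp] theorem track_cons (k : K) (v : K → Option G) (l : List (K → Option G)) :
    track k (v :: l) = v k :: track k l := rfl

omit [DecidableEq K] in
@[simp] theorem length_track (k : K) (l : List (K → Option G)) : (track k l).length = l.length :=
  List.length_map _

theorem SweepRow.length_eq {o o' : Op K G} {l l' : List (K → Option G)} (h : SweepRow o l l' o') :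
    l'.length = l.length := by
  induction h with
  | nil => rfl
  | cons _ _ ih => simp [ih]

theorem SweepRow.snoc {o o' o'' : Op K G} {l l' : List (K → Option G)} {v v' : K → Option G}
    (h : SweepRow o l l' o') (hv : Sweep o' v v' o'') :
    SweepRow o (l ++ [v]) (l' ++ [v']) o'' := by
  induction h with
  | nil => exact .cons hv (.nil _)
  | cons h1 _ ih => exact .cons h1 (ih hv)

theorem SweepRow.keep {o' : Op K G} {l l' : List (K → Option G)} (h : SweepRow .keep l l' o') :
    l' = l ∧ o' = .keep := by
  generalize ho : Op.keep = o at h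
  induction h with
  | nil => exact ⟨rfl, rfl⟩
  | cons h1 _ ih =>
    subst ho
    cases h1
    obtain ⟨h2, h3⟩ := ih rfl
    exact ⟨by rw [h2], h3⟩

/-- The sweep carries one symbol and exchanges it with the content of each cell. Track `k` is
shifted away from the top by one cell, and the symbol falling off the end is the one still carried.
-/
theorem SweepRow.push {k : K} {e : Option G} {o' : Op K G} {l l' : List (K → Option G)}
    (h : SweepRow (.push k e) l l' o') :
    ∃ e', o' = .push k e' ∧ e :: track k l = track k l' ++ [e'] ∧
      ∀ j ≠ k, track j l' = track j l := by
  generalize ho : Op.push k e = o at h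
  induction h generalizing e with
  | nil =>
    subst ho
    exact ⟨e, rfl, rfl, fun _ _ => rfl⟩
  | cons h1 _ ih =>
    subst ho
    cases h1
    obtain ⟨e', h2, h3, h4⟩ := ih rfl
    refine ⟨e', h2, by simp [h3], fun j hj => ?_⟩
    simp [h4 j hj, hj]

/-- The same relation as for a push with the two rows exchanged. The symbol written into a cell is a
guess of the content of the next one, and the last guess stays open until the sweep ends. -/
theorem SweepRow.pop {k : K} {e : Option G} {o' : Op K G} {l l' : List (K → Option G)}
    (h : SweepRow (.pop k e) l l' o') :
    ∃ e', o' = .pop k e' ∧ track k l ++ [e'] = e :: track k l' ∧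
      ∀ j ≠ k, track j l' = track j l := by
  generalize ho : Op.pop k e = o at h
  induction h generalizing e with
  | nil =>
    subst ho
    exact ⟨e, rfl, rfl, fun _ _ => rfl⟩
  | cons h1 _ ih =>
    subst ho
    cases h1
    obtain ⟨e', h2, h3, h4⟩ := ih rfl
    refine ⟨e', h2, by simp [h3], fun j hj => ?_⟩
    simp [h4 j hj, hj]

theorem exists_sweepRow_keep : ∀ l : List (K → Option G), SweepRow .keep l l .keep
  | [] => .nil _
  | v :: l => .cons (.keep v) (exists_sweepRow_keep l)

theorem exists_sweepRow_push (k : K) : ∀ (l : List (K → Option G)) (e : Option G),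
    ∃ l' o', SweepRow (.push k e) l l' o'
  | [], _ => ⟨[], _, .nil _⟩
  | v :: l, e =>
    let ⟨_, _, h⟩ := exists_sweepRow_push k l (v k)
    ⟨_, _, .cons (.push k e v) h⟩

theorem exists_sweepRow_pop (k : K) : ∀ l : List (K → Option G),
    ∃ l', SweepRow (.pop k ((track k l).headD none)) l l' (.pop k none)
  | [] => ⟨[], .nil _⟩
  | v :: l =>
    let ⟨_, h⟩ := exists_sweepRow_pop k l
    ⟨_, .cons (.pop k v _) h⟩

/-- The row `l` holds the contents of the stacks, tops first, padded with blanks. -/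
def Represents (l : List (K → Option G)) (S : K → List G) : Prop :=
  ∀ k, ∃ m, track k l = (S k).map some ++ List.replicate m none

/-- The sweep caused by the instruction at `q` when the tops of the stacks are `v`. -/
def start (M : Q → Instr K G Q) (q : Q) (v : K → Option G) : Option (Op K G × Q) :=
  match M q with
  | .push k g q => some (.push k (some g), q)
  | .pop k f => some (.pop k (v k), f (v k))
  | .peek k f => some (.keep, f (v k))
  | .halt _ _ => none

omit [DecidableEq K] in
-- The first cell shows the tops of all stacks, a blank standing for an empty stack. Therefore the
-- first letter of a row already determines the instruction's effect and the next state.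
theorem Represents.head {v : K → Option G} {l : List (K → Option G)} {S : K → List G}
    (h : Represents (v :: l) S) (k : K) : v k = (S k).head? := by
  obtain ⟨m, hm⟩ := h k
  cases hS : S k with
  | nil =>
    cases m with
    | zero => simp [hS] at hm
    | succ m =>
      simp only [hS, track_cons, List.replicate_succ, List.map_nil, List.nil_append,
        List.cons.injEq] at hm
      simp [hm.1]
  | cons g t =>
    simp only [hS, track_cons, List.map_cons, List.cons_append, List.cons.injEq] at hm
    simp [hm.1]

/-- Soundness of a sweep. The condition at its end excludes both failures: a push must not lose a
symbol over the end of the row, and the last guess of a pop must be a blank. -/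
theorem Represents.step {M : Q → Instr K G Q} {q q' : Q} {v : K → Option G}
    {l l' : List (K → Option G)} {S : K → List G} {o o' : Op K G} (h : Represents (v :: l) S)
    (hs : start M q v = some (o, q')) (hl : SweepRow o (v :: l) l' o') (hd : o'.Done) :
    ∃ S', StackMachine.step M (q, S) = some (q', S') ∧ Represents l' S' := by
  unfold start at hs
  unfold StackMachine.step
  cases hM : M q with
  | push k g p =>
    simp only [hM, Option.some.injEq, Prod.mk.injEq] at hs ⊢
    obtain ⟨rfl, rfl⟩ := hs
    obtain ⟨e, rfl, h1, h2⟩ := hl.push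
    obtain rfl : e = none := hd
    refine ⟨_, ⟨rfl, rfl⟩, fun j => ?_⟩
    by_cases hj : j = k
    · subst hj
      obtain ⟨m, hm⟩ := h j
      rw [hm] at h1
      cases m with
      -- Without padding the row has no room: the symbol falling off is not a blank, so the sweep
      -- could not have ended.
      | zero =>
        have := congrArg List.getLast? h1
        cases hS : S j <;> simp [hS] at this
        simp [List.getLast?_cons, ← List.map_cons] at this
      | succ m =>
        refine ⟨m, ?_⟩
        rw [List.replicate_succ', ← List.append_assoc, ← List.cons_append] at h1
        simp [← (List.append_inj' h1 rfl).1]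
    · rw [h2 j hj, update_of_ne hj]
      exact h j
  | pop k f =>
    simp only [hM, Option.some.injEq, Prod.mk.injEq] at hs ⊢
    obtain ⟨rfl, rfl⟩ := hs
    obtain ⟨e, rfl, h1, h2⟩ := hl.pop
    obtain rfl : e = none := hd
    refine ⟨_, ⟨by rw [h.head], rfl⟩, fun j => ?_⟩
    by_cases hj : j = k
    · subst hj
      obtain ⟨m, hm⟩ := h j
      rw [hm] at h1
      rw [update_self]
      cases hS : S j with
      | nil =>
        rw [hS, List.map_nil, List.nil_append, ← List.replicate_succ', List.replicate_succ] at h1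
        exact ⟨m, by simp [← (List.cons.inj h1).2]⟩
      | cons g t =>
        rw [hS, List.map_cons, List.cons_append, List.cons_append] at h1
        exact ⟨m + 1, by simp [← (List.cons.inj h1).2, List.replicate_succ']⟩
    · rw [h2 j hj, update_of_ne hj]
      exact h j
  | peek k f =>
    simp only [hM, Option.some.injEq, Prod.mk.injEq] at hs ⊢
    obtain ⟨rfl, rfl⟩ := hs
    obtain ⟨rfl, rfl⟩ := hl.keep
    exact ⟨_, ⟨by rw [h.head], rfl⟩, h⟩
  | halt => simp [hM] at hs

/-- Completeness of a sweep. The row has one cell more than `l`, so the bound leaves at least one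
blank on every track, which is the one that a push drops. -/
theorem Represents.exists_sweepRow {M : Q → Instr K G Q} {q q' : Q} {v : K → Option G}
    {l : List (K → Option G)} {S S' : K → List G} (h : Represents (v :: l) S)
    (hS : StackMachine.step M (q, S) = some (q', S')) (hlen : ∀ k, (S k).length ≤ l.length) :
    ∃ o l' o', start M q v = some (o, q') ∧ SweepRow o (v :: l) l' o' ∧ o'.Done ∧
      Represents l' S' := by
  suffices ∃ o l' o', start M q v = some (o, q') ∧ SweepRow o (v :: l) l' o' ∧ o'.Done by
    obtain ⟨o, l', o', h1, h2, h3⟩ := this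
    obtain ⟨T, h4, h5⟩ := h.step h1 h2 h3
    rw [hS] at h4
    obtain rfl : S' = T := by simpa using h4
    exact ⟨o, l', o', h1, h2, h3, h5⟩
  unfold StackMachine.step at hS
  unfold start
  cases hM : M q with
  | push k g p =>
    simp only [hM, Option.some.injEq, Prod.mk.injEq] at hS ⊢
    obtain ⟨rfl, rfl⟩ := hS
    obtain ⟨l', o', h1⟩ := exists_sweepRow_push k (v :: l) (some g)
    refine ⟨_, l', o', ⟨rfl, rfl⟩, h1, ?_⟩
    obtain ⟨e, rfl, h2, -⟩ := h1.push
    obtain ⟨m, hm⟩ := h k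
    have hm' := congrArg List.length hm
    have := hlen k
    simp only [length_track, List.length_cons, List.length_append, List.length_map,
      List.length_replicate] at hm'
    obtain ⟨m, rfl⟩ : ∃ m', m = m' + 1 := ⟨m - 1, by omega⟩
    rw [hm, List.replicate_succ', ← List.append_assoc, ← List.cons_append] at h2
    exact (List.cons.inj (List.append_inj' h2 rfl).2).1.symm
  | pop k f =>
    simp only [hM, Option.some.injEq, Prod.mk.injEq] at hS ⊢
    obtain ⟨rfl, rfl⟩ := hS
    obtain ⟨l', h1⟩ := exists_sweepRow_pop k (v :: l)
    exact ⟨_, l', _, ⟨rfl, by rw [h.head]⟩, h1, rfl⟩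
  | peek k f =>
    simp only [hM, Option.some.injEq, Prod.mk.injEq] at hS ⊢
    obtain ⟨rfl, rfl⟩ := hS
    exact ⟨_, _, _, ⟨rfl, by rw [h.head]⟩, exists_sweepRow_keep _, trivial⟩
  | halt => simp [hM] at hS

/-! #### The queue machine -/

/-- The control states of the transducer: the head has just read the start of a row, it is inside
a row, or the machine has accepted. -/
inductive Control (K G Q : Type) where
  | top (q : Q)
  | sweep (o : Op K G) (q : Q)
  | accept

/-- A letter of the queue: the start of a row (`none`), or one symbol for each stack. -/
abbrev Letter (K G : Type) : Type := Option (K → Option G)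

inductive Transition (M : Q → Instr K G Q) :
    Control K G Q → Letter K G → Letter K G → Control K G Q → Prop
  | turn {o : Op K G} (q : Q) : o.Done → Transition M (.sweep o q) none none (.top q)
  | sweep {o o' : Op K G} {v v' : K → Option G} (q : Q) :
      Sweep o v v' o' → Transition M (.sweep o q) (some v) (some v') (.sweep o' q)
  | start {o o' : Op K G} {v v' : K → Option G} {q q' : Q} :
      start M q v = some (o, q') → Sweep o v v' o' →
      Transition M (.top q) (some v) (some v') (.sweep o' q')
  | accept {q : Q} {k : K} {f : Option G → Prop} {v : K → Option G} :
      M q = .halt k f → f (v k) → Transition M (.top q) (some v) (some v) .accept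

/-- `QueueRun T n c c'`: the machine, which reads the front of the queue and writes at its end,
gets from `c` to `c'` in `n` steps. -/
inductive QueueRun {C A : Type} (T : C → A → A → C → Prop) : ℕ → C × List A → C × List A → Prop
  | refl (c : C × List A) : QueueRun T 0 c c
  | tail {n : ℕ} {c : C × List A} {s s' : C} {a b : A} {w : List A} :
      QueueRun T n c (s, a :: w) → T s a b s' → QueueRun T (n + 1) c (s', w ++ [b])

theorem QueueRun.trans {C A : Type} {T : C → A → A → C → Prop} {m n : ℕ} {c d e : C × List A}
    (h : QueueRun T m c d) (h' : QueueRun T n d e) : QueueRun T (m + n) c e := by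
  induction h' with
  | refl => exact h
  | tail _ hT ih => exact .tail (ih h) hT

theorem QueueRun.congr {C A : Type} {T : C → A → A → C → Prop} {m n : ℕ} {c d c' d' : C × List A}
    (h : QueueRun T m c d) (hm : m = n) (hc : c = c') (hd : d = d') : QueueRun T n c' d' :=
  hm ▸ hc ▸ hd ▸ h

theorem QueueRun.single {C A : Type} {T : C → A → A → C → Prop} {s s' : C} {a b : A} {w : List A}
    (h : T s a b s') : QueueRun T 1 (s, a :: w) (s', w ++ [b]) :=
  .tail (.refl _) h

theorem QueueRun.sweepRow {M : Q → Instr K G Q} (q : Q) {o o' : Op K G}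
    {l l' : List (K → Option G)} (h : SweepRow o l l' o') (w : List (Letter K G)) :
    QueueRun (Transition M) l.length (.sweep o q, l.map some ++ w)
      (.sweep o' q, w ++ l'.map some) := by
  induction h generalizing w with
  | nil => simpa using QueueRun.refl _
  | @cons o o' o'' v v' l l' h1 _ ih =>
    refine ((QueueRun.single (w := l.map some ++ w) (Transition.sweep (M := M) q h1)).trans
      ((ih (w ++ [some v'])).congr rfl (by simp) rfl)).congr (Nat.add_comm ..) rfl (by simp)

/-- One instruction costs one full rotation of the queue: a step for each cell and one for the
separator. -/
theorem QueueRun.step {M : Q → Instr K G Q} {q q' : Q} {l : List (K → Option G)}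
    {S S' : K → List G} (h : Represents l S) (hS : StackMachine.step M (q, S) = some (q', S'))
    (hlen : ∀ k, (S k).length < l.length) (hl : l ≠ []) :
    ∃ l', QueueRun (Transition M) (l.length + 1) (.top q, l.map some ++ [none])
      (.top q', l'.map some ++ [none]) ∧ Represents l' S' ∧ l'.length = l.length := by
  obtain ⟨v, t, rfl⟩ := List.exists_cons_of_ne_nil hl
  obtain ⟨o, l', o', h1, h2, h3, h4⟩ := h.exists_sweepRow hS fun k => Nat.le_of_lt_succ (hlen k)
  refine ⟨l', ?_, h4, h2.length_eq⟩
  cases h2 with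
  | @cons _ o1 _ _ v' _ t' hv ht =>
    refine ((QueueRun.single (w := t.map some ++ [none]) (Transition.start h1 hv)).trans
      (((QueueRun.sweepRow q' ht [none, some v']).congr rfl (by simp) rfl).trans
      (QueueRun.single (w := some v' :: t'.map some) (Transition.turn q' h3)))).congr ?_ rfl
      (by simp)
    simp only [List.length_cons]
    omega

theorem stepsTo_succ {σ : Type} {f : σ → Option σ} {a b : σ} {n : ℕ}
    (h : StackProg.StepsTo f a (n + 1) b) : ∃ a', f a = some a' ∧ StackProg.StepsTo f a' n b := by
  unfold StackProg.StepsTo at h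
  rw [Function.iterate_succ_apply] at h
  change (flip bind f)^[n] (f a) = some b at h
  cases hf : f a with
  | some a' =>
    rw [hf] at h
    exact ⟨a', rfl, h⟩
  | none =>
    rw [hf] at h
    have : ∀ n, (flip bind f)^[n] none = none := by
      intro n
      induction n with
      | zero => rfl
      | succ n ih => rw [Function.iterate_succ_apply]; exact ih
    rw [this] at h
    cases h

/-- If the stack machine accepts after `n` steps, then the queue machine accepts, provided that
the row has enough space. -/
theorem queueRun_of_stepsTo {M : Q → Instr K G Q} {c' : Q × (K → List G)} (hc' : Accepting M c') :
    ∀ {n : ℕ} {q : Q} {S : K → List G} {l : List (K → Option G)}, Represents l S →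
      (∀ k, (S k).length + n < l.length) → l ≠ [] →
      StackProg.StepsTo (StackMachine.step M) (q, S) n c' →
      ∃ w, QueueRun (Transition M) (n * (l.length + 1) + 1) (.top q, l.map some ++ [none])
        (.accept, w)
  | 0, q, S, l, h, _, hl, hs => by
    obtain rfl : (q, S) = c' := by simpa [StackProg.StepsTo] using hs
    obtain ⟨v, t, rfl⟩ := List.exists_cons_of_ne_nil hl
    obtain ⟨k, f, h1, h2⟩ := hc'
    exact ⟨_, (QueueRun.single (w := t.map some ++ [none])
      (Transition.accept (v := v) h1 (by rw [h.head]; exact h2))).congr (by simp) rfl rfl⟩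
  | n + 1, q, S, l, h, hlen, hl, hs => by
    obtain ⟨⟨q', S'⟩, h1, h2⟩ := stepsTo_succ hs
    obtain ⟨l', h3, h4, h5⟩ := QueueRun.step h h1 (fun k => by have := hlen k; omega) hl
    -- An instruction lengthens a stack by at most one, so the bound on stack height plus remaining
    -- steps is preserved.
    have hlen' : ∀ k, (S' k).length ≤ (S k).length + 1 := by
      intro k
      unfold StackMachine.step at h1
      split at h1 <;> simp only [Option.some.injEq, Prod.mk.injEq, reduceCtorEq] at h1 <;>
        obtain ⟨-, rfl⟩ := h1
      · rename_i k' g _ _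
        by_cases hk : k = k'
        · subst hk; simp
        · simp [hk]
      · rename_i k' f _
        by_cases hk : k = k'
        · subst hk; simp; omega
        · simp [hk]
      · simp
    obtain ⟨w, hw⟩ := queueRun_of_stepsTo hc' h4
      (fun k => by have := hlen k; have := hlen' k; omega)
      (by rw [← List.length_pos_iff, h5]; exact List.length_pos_iff.2 hl) h2
    exact ⟨w, (h3.trans hw).congr (by rw [h5, Nat.succ_mul]; omega) rfl rfl⟩

/-- Reachability of configurations of the stack machine. -/
abbrev Reaches (M : Q → Instr K G Q) : Q × (K → List G) → Q × (K → List G) → Prop :=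
  StateTransition.Reaches (StackMachine.step M)

/-- What the configurations of the queue machine say about the stack machine started in `c₀`. -/
inductive Simulates (M : Q → Instr K G Q) (c₀ : Q × (K → List G)) :
    Control K G Q × List (Letter K G) → Prop
  | top {q : Q} {l : List (K → Option G)} {S : K → List G} :
      Represents l S → Reaches M c₀ (q, S) → Simulates M c₀ (.top q, l.map some ++ [none])
  | sweep {o o' : Op K G} {q : Q} {l l' r : List (K → Option G)} : SweepRow o l l' o' →
      (∀ m o'', SweepRow o (l ++ r) m o'' → o''.Done → ∃ S, Represents m S ∧ Reaches M c₀ (q, S)) →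
      Simulates M c₀ (.sweep o' q, r.map some ++ none :: l'.map some)
  | accept {c : Q × (K → List G)} {w : List (Letter K G)} :
      Reaches M c₀ c → Accepting M c → Simulates M c₀ (.accept, w)

/-- Inside a sweep a wrong guess may not have been detected yet, so nothing can be said about the
half-rewritten row itself. The invariant instead speaks about all successful completions of the
sweep, and it is cashed in when the separator is reached. -/
theorem Simulates.step {M : Q → Instr K G Q} {c₀ : Q × (K → List G)} {s s' : Control K G Q}
    {a b : Letter K G} {w : List (Letter K G)} (h : Simulates M c₀ (s, a :: w))
    (hT : Transition M s a b s') : Simulates M c₀ (s', w ++ [b]) := by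
  generalize hc : (s, a :: w) = c at h
  cases h with
  | @top q l S h1 h2 =>
    obtain ⟨rfl, hw⟩ := Prod.mk.inj hc
    cases l with
    | nil =>
      obtain ⟨rfl, -⟩ := List.cons.inj hw
      cases hT
    | cons v l =>
      rw [List.map_cons, List.cons_append] at hw
      obtain ⟨rfl, rfl⟩ := List.cons.inj hw
      cases hT with
      | @start o o' _ v' _ q' h3 h4 =>
        rw [List.append_assoc]
        refine .sweep (.cons h4 (.nil _)) (fun m o'' h5 h6 => ?_)
        obtain ⟨S', h7, h8⟩ := h1.step h3 h5 h6
        exact ⟨S', h8, h2.tail h7⟩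
      | accept h3 h4 => exact .accept h2 ⟨_, _, h3, by rw [← h1.head]; exact h4⟩
  | @sweep o o' q l l' r h1 h2 =>
    obtain ⟨rfl, hw⟩ := Prod.mk.inj hc
    cases r with
    | nil =>
      obtain ⟨rfl, rfl⟩ := List.cons.inj hw
      cases hT with
      | turn _ h3 =>
        obtain ⟨S, h4, h5⟩ := h2 l' o' (by simpa using h1) h3
        exact .top h4 h5
    | cons v r =>
      rw [List.map_cons, List.cons_append] at hw
      obtain ⟨rfl, rfl⟩ := List.cons.inj hw
      cases hT with
      | @sweep _ o'' _ v' _ h3 =>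
        have := Simulates.sweep (r := r) (h1.snoc h3) (by simpa using h2)
        simpa using this
  | accept h1 h2 =>
    obtain ⟨rfl, -⟩ := Prod.mk.inj hc
    cases hT

theorem accepts_of_queueRun {M : Q → Instr K G Q} {q : Q} {S : K → List G}
    {l : List (K → Option G)} (hl : Represents l S) {n : ℕ} {w : List (Letter K G)}
    (h : QueueRun (Transition M) n (.sweep .keep q, none :: l.map some) (.accept, w)) :
    ∃ c, Reaches M (q, S) c ∧ Accepting M c := by
  have key : ∀ c, QueueRun (Transition M) n (.sweep .keep q, none :: l.map some) c →
      Simulates M (q, S) c := by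
    clear h
    intro c h
    generalize hs : (Control.sweep Op.keep q, none :: l.map some) = c₀ at h
    induction h with
    | refl =>
      subst hs
      -- The initial configuration counts as the end of an idle sweep: the whole row has been passed
      -- unchanged and the separator is next.
      refine Simulates.sweep (r := []) (exists_sweepRow_keep l) (fun m o h1 _ => ⟨S, ?_, .refl⟩)
      rw [List.append_nil] at h1
      exact h1.keep.1 ▸ hl
    | tail _ hT ih => exact (ih hs).step hT
  have := key _ h
  generalize hc : (Control.accept, w) = c at this
  cases this with
  | top => cases hc
  | sweep => cases hc
  | accept h1 h2 => exact ⟨_, h1, h2⟩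

end StackMachine

/-! ### Queue machines as masters -/

namespace NonAtomic

open StackProg StackMachine

/-- A nondeterministic queue machine. Its queue initially holds a separator, the letters of the
input, the letters of a guessed word, and blanks. -/
structure QueueMachine (C A : Type) where
  trans : C → A → A → C → Prop
  init : C
  accept : C
  input : Bool → A
  guess : Bool → A
  blank : A
  sep : A

/-- The phases of the master: writing the input and a guessed word, writing blanks, being in a
control state, and being about to write a letter and to enter a control state. -/
inductive Phase (C A : Type) where
  | guess
  | blank
  | run (c : C)
  | emit (b : A) (c : C)

/-- The state of the master: the goal, or a phase together with the position of the next letter. -/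
abbrev MState (C A : Type) : Type := Option (ℕ × Phase C A)

namespace QueueMachine

variable {C A : Type} (m : QueueMachine C A)

/-- The initial queue, with `W` letters after the input. -/
def queue (W : ℕ) (x y : List Bool) : List A :=
  m.sep :: (x.map m.input ++ (y.map m.guess ++ List.replicate (W - y.length) m.blank))

/-- The rules of the master for the input `x`, guesses of length at most `p`, `W` letters after the
input and `N` steps of the queue machine. -/
inductive Rules (x : List Bool) (p W N : ℕ) : Arc (MState C A) (ℕ × A) → Prop
  | input (i : ℕ) (hi : i < x.length) :
      Rules x p W N ⟨some (i + 1, .guess), .write (i + 1, m.input x[i]), some (i + 2, .guess)⟩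
  | guess (j : ℕ) (b : Bool) (hj : j < p) : Rules x p W N
      ⟨some (j + x.length + 1, .guess), .write (j + x.length + 1, m.guess b),
        some (j + x.length + 2, .guess)⟩
  | blankStart (j : ℕ) (hj : j < W) : Rules x p W N
      ⟨some (j + x.length + 1, .guess), .write (j + x.length + 1, m.blank),
        some (j + x.length + 2, .blank)⟩
  | blank (j : ℕ) (hj : j < W) : Rules x p W N
      ⟨some (j + x.length + 1, .blank), .write (j + x.length + 1, m.blank),
        some (j + x.length + 2, .blank)⟩
  | start (r : ℕ) (hr : r < N) : Rules x p W N
      ⟨some (r + (x.length + 1 + W), .blank), .silent, some (r + (x.length + 1 + W), .run m.init)⟩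
  | accept (r : ℕ) (hr : r < N) : Rules x p W N
      ⟨some (r + (x.length + 1 + W), .run m.accept), .silent, none⟩
  | read (r : ℕ) (hr : r < N) {c c' : C} {a b : A} (h : m.trans c a b c') : Rules x p W N
      ⟨some (r + (x.length + 1 + W), .run c), .read (r, a),
        some (r + (x.length + 1 + W), .emit b c')⟩
  | write (r : ℕ) (hr : r < N) (b : A) (c : C) : Rules x p W N
      ⟨some (r + (x.length + 1 + W), .emit b c), .write (r + (x.length + 1 + W), b),
        some (r + (x.length + 1 + W) + 1, .run c)⟩

/-- The facts that describe the letters of `l`. -/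
def facts (l : List A) : Set (ℕ × A) := {f | l[f.1]? = some f.2}

/-- This identity is why a memory that only grows is enough: appending a letter adds one fact and
invalidates none. -/
theorem facts_snoc (l : List A) (b : A) : facts (l ++ [b]) = insert (l.length, b) (facts l) := by
  ext ⟨i, a⟩
  simp only [facts, Set.mem_ofPred_eq, Set.mem_insert_iff, Prod.mk.injEq]
  rcases lt_trichotomy i l.length with h | h | h
  · rw [List.getElem?_append_left h]
    constructor
    · exact Or.inr
    · rintro (⟨rfl, -⟩ | h')
      · exact absurd h (lt_irrefl _)
      · exact h'
  · subst h
    simp [eq_comm]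
  · rw [List.getElem?_eq_none (by simp; omega), List.getElem?_eq_none h.le]
    simp; omega

theorem facts_singleton (a : A) : facts [a] = {(0, a)} := by
  simpa [facts] using facts_snoc ([] : List A) a

variable {m} {x : List Bool} {p W N : ℕ} {l : List (Arc (MState C A) (ℕ × A))}

theorem map_take_succ {α β : Type} (f : α → β) {l : List α} {i : ℕ} (hi : i < l.length) :
    (l.take (i + 1)).map f = (l.take i).map f ++ [f l[i]] := by
  rw [← List.take_append_getElem hi, List.map_append]
  rfl

/-- What a state of the master says about the letters `tp` written so far. -/
def Invariant (m : QueueMachine C A) (x : List Bool) (p W : ℕ) (tp : List A) : MState C A → Prop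
  | some (i, .guess) => tp.length = i ∧ ∃ y : List Bool, y.length ≤ p ∧
      tp = m.sep :: ((x.take (i - 1)).map m.input ++ y.map m.guess)
  | some (i, .blank) => tp.length = i ∧ i ≤ x.length + 1 + W ∧ ∃ (y : List Bool) (k : ℕ),
      y.length ≤ p ∧
      tp = m.sep :: (x.map m.input ++ (y.map m.guess ++ List.replicate k m.blank))
  | some (i, .run c) => tp.length = i ∧ x.length + 1 + W ≤ i ∧ ∃ y : List Bool, y.length ≤ p ∧
      ∃ k, QueueRun m.trans k (m.init, m.queue W x y) (c, tp.drop (i - (x.length + 1 + W)))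
  | some (i, .emit b c') => tp.length = i ∧ x.length + 1 + W ≤ i ∧ ∃ y : List Bool, y.length ≤ p ∧
      ∃ k c a w, QueueRun m.trans k (m.init, m.queue W x y) (c, a :: w) ∧
        tp.drop (i - (x.length + 1 + W)) = a :: w ∧ m.trans c a b c'
  | none => ∃ y : List Bool, y.length ≤ p ∧ ∃ k w,
      QueueRun m.trans k (m.init, m.queue W x y) (m.accept, w)

/-- The position in the state is always the length of the tape, so every write appends a letter. The
facts therefore never contradict each other, and a read at position `r` returns the actual front of
the queue. -/
theorem invariant_of_factReach (hl : ∀ r ∈ l, m.Rules x p W N r) {q : MState C A}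
    {F : Set (ℕ × A)} (h : FactReach l (some (1, .guess), {(0, m.sep)}) (q, F)) :
    ∃ tp, F = facts tp ∧ m.Invariant x p W tp q := by
  generalize hc : (q, F) = c at h
  induction h generalizing q F with
  | refl =>
    obtain ⟨rfl, rfl⟩ := Prod.mk.inj hc
    exact ⟨[m.sep], (facts_singleton _).symm, rfl, [], Nat.zero_le _, by simp⟩
  | tail _ hstep ih =>
    subst hc
    cases hstep with
    | @silent s _ _ hrl =>
      obtain ⟨tp, rfl, hI⟩ := ih rfl
      refine ⟨tp, rfl, ?_⟩
      cases hl _ hrl with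
      | start r hr =>
        obtain ⟨h1, h2, y, k, hy, h3⟩ := hI
        -- The rule is listed for every `r < N`, but positions in the blank phase do not exceed
        -- `x.length + 1 + W`.
        obtain rfl : r = 0 := by omega
        refine ⟨h1, by omega, y, hy, 0, ?_⟩
        -- The length of the tape forces the number of blanks, so the tape is the initial queue for
        -- the guessed word.
        have hk : k = W - y.length := by
          rw [h3] at h1
          simp at h1
          omega
        rw [Nat.zero_add, Nat.sub_self, List.drop_zero, h3, hk]
        exact .refl _
      | accept r hr =>
        obtain ⟨h1, h2, y, hy, k, h3⟩ := hI
        exact ⟨y, hy, k, _, h3⟩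
    | @read s _ _ φ hrl hφ =>
      obtain ⟨tp, rfl, hI⟩ := ih rfl
      refine ⟨tp, rfl, ?_⟩
      cases hl _ hrl with
      | @read r hr c c' a b hT =>
        obtain ⟨h1, h2, y, hy, k, h3⟩ := hI
        rw [Nat.add_sub_cancel] at h3
        have h4 : tp.drop r = a :: tp.drop (r + 1) := by
          obtain ⟨hr', rfl⟩ := List.getElem?_eq_some_iff.1 (show tp[r]? = some a from hφ)
          exact List.drop_eq_getElem_cons hr'
        refine ⟨h1, h2, y, hy, k, c, a, tp.drop (r + 1), h4 ▸ h3, ?_, hT⟩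
        rw [Nat.add_sub_cancel, h4]
    | @write s _ F φ hrl =>
      obtain ⟨tp, rfl, hI⟩ := ih rfl
      suffices ∀ i b, φ = (i, b) → tp.length = i ∧ m.Invariant x p W (tp ++ [b]) q by
        obtain ⟨h0, h⟩ := this φ.1 φ.2 rfl
        exact ⟨tp ++ [φ.2], by rw [facts_snoc, h0], h⟩
      rintro i b rfl
      cases hl _ hrl with
      | input i hi =>
        obtain ⟨h1, y, hy, h2⟩ := hI
        refine ⟨h1, by simp [h1], [], Nat.zero_le _, ?_⟩
        -- As long as the input is incomplete, the position leaves no room for guessed letters.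
        have hy' : y = [] := by
          rw [h2] at h1
          simp at h1
          exact List.length_eq_zero_iff.1 (by omega)
        subst hy'
        rw [h2, show i + 2 - 1 = i + 1 from rfl, map_take_succ _ hi]
        simp only [List.map_nil, List.append_nil, List.cons_append, Nat.add_sub_cancel]
      | guess j b hj =>
        obtain ⟨h1, y, hy, h2⟩ := hI
        refine ⟨h1, by simp [h1], y ++ [b], ?_, ?_⟩
        · rw [h2] at h1
          simp at h1
          simp
          omega
        · rw [h2, List.take_of_length_le (by omega), List.take_of_length_le (by omega)]
          simp
      | blankStart j hj =>
        obtain ⟨h1, y, hy, h2⟩ := hI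
        refine ⟨h1, by simp [h1], by omega, y, 1, hy, ?_⟩
        rw [h2, List.take_of_length_le (by omega)]
        simp
      | blank j hj =>
        obtain ⟨h1, h2, y, k, hy, h3⟩ := hI
        refine ⟨h1, by simp [h1], by omega, y, k + 1, hy, ?_⟩
        rw [h3]
        simp [List.replicate_succ']
      | write r hr b c =>
        obtain ⟨h1, h2, y, hy, k, c', a, w, h3, h4, h5⟩ := hI
        refine ⟨h1, by simp [h1], by omega, y, hy, k + 1, ?_⟩
        rw [Nat.add_sub_cancel] at h4
        have h6 : tp.drop (r + 1) = w := by rw [← List.drop_drop, h4]; rfl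
        rw [show r + (x.length + 1 + W) + 1 - (x.length + 1 + W) = r + 1 by omega,
          List.drop_append_of_le_length (by omega), h6]
        exact .tail h3 h5

/-- The run is replayed phase by phase. The strict inequality `p < W` guarantees at least one blank,
and writing a blank is the only way out of the guessing phase. -/
theorem factReach_of_queueRun (hl : ∀ r, m.Rules x p W N r → r ∈ l) {y : List Bool}
    (hy : y.length ≤ p) (hpW : p < W) {k : ℕ} (hk : k < N) {w : List A}
    (h : QueueRun m.trans k (m.init, m.queue W x y) (m.accept, w)) :
    ∃ F, FactReach l (some (1, .guess), {(0, m.sep)}) (none, F) := by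
  have write : ∀ {i : ℕ} {b : A} {s t : MState C A} {tp : List A}, tp.length = i →
      m.Rules x p W N ⟨s, .write (i, b), t⟩ →
      FactReach l (some (1, .guess), {(0, m.sep)}) (s, facts tp) →
      FactReach l (some (1, .guess), {(0, m.sep)}) (t, facts (tp ++ [b])) := by
    rintro i b s t tp rfl hr h
    rw [facts_snoc]
    exact h.tail (.write _ (hl _ hr))
  have h1 : ∀ i ≤ x.length, FactReach l (some (1, .guess), {(0, m.sep)})
      (some (i + 1, .guess), facts (m.sep :: (x.take i).map m.input)) := by
    intro i
    induction i with
    | zero =>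
      intro _
      rw [List.take_zero, List.map_nil, facts_singleton]
      exact .refl
    | succ i ih =>
      intro hi
      have := write (by simp; omega) (.input i hi) (ih (by omega))
      rwa [show m.sep :: (x.take (i + 1)).map m.input =
        m.sep :: (x.take i).map m.input ++ [m.input x[i]] by
          rw [map_take_succ _ hi, List.cons_append]]
  have h2 : ∀ j ≤ y.length, FactReach l (some (1, .guess), {(0, m.sep)})
      (some (j + x.length + 1, .guess),
        facts (m.sep :: (x.map m.input ++ (y.take j).map m.guess))) := by
    intro j
    induction j with
    | zero =>
      intro _
      simpa using h1 x.length le_rfl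
    | succ j ih =>
      intro hj
      have := write (by simp; omega) (.guess j y[j] (by omega)) (ih (by omega))
      rw [show j + 1 + x.length + 1 = j + x.length + 2 by omega]
      rwa [show m.sep :: (x.map m.input ++ (y.take (j + 1)).map m.guess) =
        m.sep :: (x.map m.input ++ (y.take j).map m.guess) ++ [m.guess y[j]] by
          rw [map_take_succ _ hj, List.cons_append, List.append_assoc]]
  have h3 : ∀ i, y.length + i < W → FactReach l (some (1, .guess), {(0, m.sep)})
      (some (y.length + i + x.length + 2, .blank), facts (m.sep :: (x.map m.input ++
        (y.map m.guess ++ List.replicate (i + 1) m.blank)))) := by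
    intro i
    induction i with
    | zero =>
      intro hi
      have := write (by simp [Nat.add_comm]) (.blankStart y.length hi) (h2 y.length le_rfl)
      simpa using this
    | succ i ih =>
      intro hi
      have := write (tp := m.sep :: (x.map m.input ++
        (y.map m.guess ++ List.replicate (i + 1) m.blank))) (by simp; omega) (.blank (y.length + (i + 1)) hi) (by
        rw [show y.length + (i + 1) + x.length + 1 = y.length + i + x.length + 2 by omega]
        exact ih (by omega))
      rw [List.replicate_succ' (n := i + 1)]
      simpa using this
  have h4 : FactReach l (some (1, .guess), {(0, m.sep)})
      (some (x.length + 1 + W, .run m.init), facts (m.queue W x y)) := by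
    have h5 := h3 (W - y.length - 1) (by omega)
    rw [show y.length + (W - y.length - 1) + x.length + 2 = x.length + 1 + W by omega,
      show W - y.length - 1 + 1 = W - y.length by omega] at h5
    have h6 := Rules.start (m := m) (x := x) (p := p) (W := W) (N := N) 0 (by omega)
    rw [Nat.zero_add] at h6
    exact h5.tail (.silent _ (hl _ h6))
  have hq : (m.queue W x y).length = x.length + 1 + W := by
    simp [queue]
    omega
  -- After `k` steps the tape has `k` letters more than the queue; the queue is the tape without its
  -- first `k` letters.
  have h5 : ∀ k d, k ≤ N → QueueRun m.trans k (m.init, m.queue W x y) d →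
      ∃ tp : List A, tp.length = k + (x.length + 1 + W) ∧ tp.drop k = d.2 ∧
        FactReach l (some (1, .guess), {(0, m.sep)})
          (some (k + (x.length + 1 + W), .run d.1), facts tp) := by
    intro k d hk h
    generalize hc : (m.init, m.queue W x y) = c at h
    induction h with
    | refl =>
      subst hc
      exact ⟨_, by simpa using hq, rfl, by simpa using h4⟩
    | @tail k c s s' a b w _ hT ih =>
      obtain ⟨tp, e1, e2, e3⟩ := ih (by omega) hc
      refine ⟨tp ++ [b], by simp [e1]; omega, ?_, ?_⟩
      · rw [List.drop_append_of_le_length (by omega), ← List.drop_drop, e2]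
        rfl
      · rw [show k + 1 + (x.length + 1 + W) = k + (x.length + 1 + W) + 1 by omega]
        refine write e1 (.write k (by omega) b s') ?_
        refine e3.tail (.read (hl _ (.read k (by omega) hT)) ?_)
        change tp[k]? = some a
        rw [← Nat.add_zero k, ← List.getElem?_drop, e2]
        rfl
  obtain ⟨tp, -, -, e3⟩ := h5 k _ hk.le h
  exact ⟨_, e3.tail (.silent _ (hl _ (.accept k hk)))⟩

/-- The master has rules for only `N` steps. The hypothesis `hN` supplies a short accepting run
whenever there is any, so this truncation loses nothing. -/
theorem factReach_iff (hl : ∀ r, r ∈ l ↔ m.Rules x p W N r) (hpW : p < W)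
    (hN : ∀ y : List Bool, y.length ≤ p → ∀ k w,
      QueueRun m.trans k (m.init, m.queue W x y) (m.accept, w) →
      ∃ k < N, ∃ w, QueueRun m.trans k (m.init, m.queue W x y) (m.accept, w)) :
    (∃ F, FactReach l (some (1, .guess), {(0, m.sep)}) (none, F)) ↔
      ∃ y : List Bool, y.length ≤ p ∧
        ∃ k w, QueueRun m.trans k (m.init, m.queue W x y) (m.accept, w) := by
  constructor
  · rintro ⟨F, hF⟩
    obtain ⟨tp, -, h⟩ := invariant_of_factReach (fun r hr => (hl r).1 hr) hF
    exact h
  · rintro ⟨y, hy, k, w, h⟩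
    obtain ⟨k, hk, w, h⟩ := hN y hy k w h
    exact factReach_of_queueRun (fun r hr => (hl r).2 hr) hy hpW hk h

end QueueMachine

end NonAtomic

/-! ### Machines with statements as stack machines -/

namespace StackMachine

open Turing StackProg Function

variable (tm : FinTM2)

/-- The statements that occur in the program of the machine. -/
def SubStmt : Type := {s : TM2.Stmt tm.Γ tm.Λ tm.σ // ∃ l, s ∈ TM2.stmts₁ (tm.m l)}

/-- Finiteness of the program is what bounds the stack alphabet: the types `tm.Γ k` for `k ≠ tm.k₀`
may be infinite, but each pushed symbol is determined by a push statement and an internal state. -/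
instance : Finite (SubStmt tm) := by
  have := tm.ΛFin
  have h : {s : TM2.Stmt tm.Γ tm.Λ tm.σ | ∃ l, s ∈ TM2.stmts₁ (tm.m l)} =
      ⋃ l, (TM2.stmts₁ (tm.m l) : Set _) := by
    ext s
    simp
  exact (h ▸ Set.finite_iUnion fun l => Finset.finite_toSet _ :
    {s : TM2.Stmt tm.Γ tm.Λ tm.σ | ∃ l, s ∈ TM2.stmts₁ (tm.m l)}.Finite)

abbrev Micro : Type := SubStmt tm × tm.σ

/-- A stack symbol is an input symbol or was produced by a statement in an internal state. -/
abbrev Symbol : Type := tm.Γ tm.k₀ ⊕ Micro tm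

variable {tm}

theorem SubStmt.of_mem {s t : TM2.Stmt tm.Γ tm.Λ tm.σ} (h : ∃ l, s ∈ TM2.stmts₁ (tm.m l))
    (ht : t ∈ TM2.stmts₁ s) : ∃ l, t ∈ TM2.stmts₁ (tm.m l) :=
  let ⟨l, hl⟩ := h
  ⟨l, TM2.stmts₁_trans hl ht⟩

def SubStmt.ofLabel (l : tm.Λ) : SubStmt tm := ⟨tm.m l, l, TM2.stmts₁_self⟩

/-- The symbol of stack `k` that is meant. -/
def decode (k : tm.K) : Symbol tm → Option (tm.Γ k)
  | .inl a => if h : tm.k₀ = k then some (h ▸ a) else none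
  | .inr (⟨.push k' f _, _⟩, v) => if h : k' = k then some (h ▸ f v) else none
  | .inr _ => none

/-- The machine that executes one basic instruction at a time. It accepts if `good` holds of the
top of the output stack. -/
def micro (good : tm.Γ tm.k₁ → Prop) : Micro tm → Instr tm.K (Symbol tm) (Micro tm)
  | (⟨.push k f q, h⟩, v) => .push k (.inr (⟨.push k f q, h⟩, v))
      (⟨q, SubStmt.of_mem h (by simp [TM2.stmts₁, TM2.stmts₁_self])⟩, v)
  | (⟨.peek k f q, h⟩, v) => .peek k fun e =>
      (⟨q, SubStmt.of_mem h (by simp [TM2.stmts₁, TM2.stmts₁_self])⟩, f v (e.bind (decode k)))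
  | (⟨.pop k f q, h⟩, v) => .pop k fun e =>
      (⟨q, SubStmt.of_mem h (by simp [TM2.stmts₁, TM2.stmts₁_self])⟩, f v (e.bind (decode k)))
  | (⟨.load a q, h⟩, v) => .peek tm.k₀ fun _ =>
      (⟨q, SubStmt.of_mem h (by simp [TM2.stmts₁, TM2.stmts₁_self])⟩, a v)
  | (⟨.branch f q r, h⟩, v) => .peek tm.k₀ fun _ =>
      (bif f v then ⟨q, SubStmt.of_mem h (by simp [TM2.stmts₁, TM2.stmts₁_self])⟩
        else ⟨r, SubStmt.of_mem h (by simp [TM2.stmts₁, TM2.stmts₁_self])⟩, v)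
  | (⟨.goto f, _⟩, v) => .peek tm.k₀ fun _ => (SubStmt.ofLabel (f v), v)
  | (⟨.halt, _⟩, _) => .halt tm.k₁ fun e => ∃ g, e.bind (decode tm.k₁) = some g ∧ good g

/-- The symbols on the stacks `S` mean the contents of `T`. -/
def Means (S : tm.K → List (Symbol tm)) (T : ∀ k, List (tm.Γ k)) : Prop :=
  ∀ k, (S k).map (decode k) = (T k).map some

theorem Means.head {S : tm.K → List (Symbol tm)} {T : ∀ k, List (tm.Γ k)} (h : Means S T)
    (k : tm.K) : (S k).head?.bind (decode k) = (T k).head? := by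
  have h := h k
  cases hS : S k <;> cases hT : T k <;> simp_all

theorem Means.push {S : tm.K → List (Symbol tm)} {T : ∀ k, List (tm.Γ k)} (h : Means S T)
    {k : tm.K} {a : Symbol tm} {b : tm.Γ k} (hab : decode k a = some b) :
    Means (update S k (a :: S k)) (update T k (b :: T k)) := by
  intro j
  by_cases hj : j = k
  · subst hj
    simp [hab, h j]
  · simp [hj, h j]

theorem Means.pop {S : tm.K → List (Symbol tm)} {T : ∀ k, List (tm.Γ k)} (h : Means S T)
    (k : tm.K) : Means (update S k (S k).tail) (update T k (T k).tail) := by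
  intro j
  by_cases hj : j = k
  · subst hj
    simp [List.map_tail, h j]
  · simp [hj, h j]

/-- The number of basic instructions of a statement. -/
def depth {K : Type} {Γ : K → Type} {Λ σ : Type} : TM2.Stmt Γ Λ σ → ℕ
  | .push _ _ q => depth q + 1
  | .peek _ _ q => depth q + 1
  | .pop _ _ q => depth q + 1
  | .load _ q => depth q + 1
  | .branch _ q r => max (depth q) (depth r) + 1
  | .goto _ => 1
  | .halt => 1

/-- The statement to be executed at a configuration. -/
def stmtAt (c : TM2.Cfg tm.Γ tm.Λ tm.σ) : TM2.Stmt tm.Γ tm.Λ tm.σ :=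
  match c.l with
  | some l => tm.m l
  | none => .halt

def Matches (d : Micro tm × (tm.K → List (Symbol tm))) (c : TM2.Cfg tm.Γ tm.Λ tm.σ) : Prop :=
  d.1.1.1 = stmtAt c ∧ d.1.2 = c.var ∧ Means d.2 c.stk

/-- A statement is unfolded into its basic instructions along the branch actually taken, hence the
bound by the depth. The final `halt` costs nothing, since the micro machine stops there as well. -/
theorem exists_stepsTo_stepAux (good : tm.Γ tm.k₁ → Prop) (s : TM2.Stmt tm.Γ tm.Λ tm.σ) :
    ∀ (h : ∃ l, s ∈ TM2.stmts₁ (tm.m l)) (v : tm.σ) (S : tm.K → List (Symbol tm))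
      (T : ∀ k, List (tm.Γ k)), Means S T → ∃ n ≤ depth s, ∃ d,
        StepsTo (step (micro good)) ((⟨s, h⟩, v), S) n d ∧ Matches d (TM2.stepAux s v T) := by
  have key : ∀ {c d e : Micro tm × (tm.K → List (Symbol tm))} {n : ℕ},
      step (micro good) c = some d → StepsTo (step (micro good)) d n e →
      StepsTo (step (micro good)) c (n + 1) e := by
    intro c d e n h1 h2
    rw [Nat.add_comm]
    exact (StepsTo.single h1).trans h2
  induction s with
  | push k f q ih =>
    intro h v S T hT
    obtain ⟨n, hn, d, h1, h2⟩ := ih (SubStmt.of_mem h (by simp [TM2.stmts₁, TM2.stmts₁_self])) v _ _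
      (hT.push (a := .inr (⟨.push k f q, h⟩, v)) (b := f v) (by simp [decode]))
    exact ⟨n + 1, by simpa [depth] using hn, d, key rfl h1, h2⟩
  | peek k f q ih =>
    intro h v S T hT
    obtain ⟨n, hn, d, h1, h2⟩ := ih (SubStmt.of_mem h (by simp [TM2.stmts₁, TM2.stmts₁_self]))
      (f v (T k).head?) _ _ hT
    refine ⟨n + 1, by simpa [depth] using hn, d, key ?_ h1, h2⟩
    rw [← hT.head k]
    rfl
  | pop k f q ih =>
    intro h v S T hT
    obtain ⟨n, hn, d, h1, h2⟩ := ih (SubStmt.of_mem h (by simp [TM2.stmts₁, TM2.stmts₁_self]))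
      (f v (T k).head?) _ _ (hT.pop k)
    refine ⟨n + 1, by simpa [depth] using hn, d, key ?_ h1, h2⟩
    rw [← hT.head k]
    rfl
  | load a q ih =>
    intro h v S T hT
    obtain ⟨n, hn, d, h1, h2⟩ := ih (SubStmt.of_mem h (by simp [TM2.stmts₁, TM2.stmts₁_self]))
      (a v) _ _ hT
    exact ⟨n + 1, by simpa [depth] using hn, d, key rfl h1, h2⟩
  | branch f q r ihq ihr =>
    intro h v S T hT
    cases hf : f v with
    | true =>
      obtain ⟨n, hn, d, h1, h2⟩ := ihq (SubStmt.of_mem h (by simp [TM2.stmts₁, TM2.stmts₁_self]))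
        v _ _ hT
      refine ⟨n + 1, by simpa [depth] using Or.inl hn, d, key ?_ h1, ?_⟩
      · simp [step, micro, hf]
        rfl
      · simpa [hf] using h2
    | false =>
      obtain ⟨n, hn, d, h1, h2⟩ := ihr (SubStmt.of_mem h (by simp [TM2.stmts₁, TM2.stmts₁_self]))
        v _ _ hT
      refine ⟨n + 1, by simpa [depth] using Or.inr hn, d, key ?_ h1, ?_⟩
      · simp [step, micro, hf]
        rfl
      · simpa [hf] using h2
  | goto f =>
    intro h v S T hT
    exact ⟨1, le_rfl, ((SubStmt.ofLabel (f v), v), S), StepsTo.single rfl, rfl, rfl, hT⟩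
  | halt =>
    intro h v S T hT
    exact ⟨0, Nat.zero_le _, ((⟨.halt, h⟩, v), S), rfl, rfl, rfl, hT⟩

theorem exists_stepsTo (good : tm.Γ tm.k₁ → Prop) {D : ℕ} (hD : ∀ l, depth (tm.m l) ≤ D)
    {c' : TM2.Cfg tm.Γ tm.Λ tm.σ} : ∀ {n : ℕ} {c : TM2.Cfg tm.Γ tm.Λ tm.σ}
      {d : Micro tm × (tm.K → List (Symbol tm))}, Matches d c → StepsTo (TM2.step tm.m) c n c' →
      ∃ N ≤ n * D, ∃ d', StepsTo (step (micro good)) d N d' ∧ Matches d' c'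
  | 0, c, d, hd, h => by
    obtain rfl : c = c' := by simpa [StepsTo] using h
    exact ⟨0, Nat.zero_le _, d, rfl, hd⟩
  | n + 1, c, d, hd, h => by
    obtain ⟨c₁, h1, h2⟩ := stepsTo_succ h
    obtain ⟨⟨⟨s, hs⟩, v⟩, S⟩ := d
    obtain ⟨l, w, T⟩ := c
    cases l with
    | none => simp at h1
    | some l =>
      obtain ⟨rfl, rfl, hT⟩ : s = tm.m l ∧ v = w ∧ Means S T := hd
      obtain rfl : TM2.stepAux (tm.m l) v T = c₁ := by simpa using h1
      obtain ⟨i, hi, d₁, h3, h4⟩ := exists_stepsTo_stepAux good (tm.m l) hs v S T hT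
      obtain ⟨N, hN, d', h5, h6⟩ := exists_stepsTo good hD h4 h2
      refine ⟨i + N, ?_, d', h3.trans h5, h6⟩
      have := hD l
      rw [Nat.succ_mul]
      omega

/-- The stacks with the word `w` on the input stack. -/
def inputStacks (w : List (tm.Γ tm.k₀)) : tm.K → List (Symbol tm) :=
  fun k => if k = tm.k₀ then w.map .inl else []

theorem means_inputStacks (w : List (tm.Γ tm.k₀)) : Means (inputStacks w) (initList tm w).stk := by
  intro k
  by_cases hk : k = tm.k₀
  · subst hk
    simp [inputStacks, initList, decode]
  · simp [inputStacks, initList, hk]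

def startState : Micro tm := (SubStmt.ofLabel tm.main, tm.initialState)

/-- If the machine halts with output `a`, the micro machine halts, accepting if and only if `a` is
good. -/
theorem exists_stepsTo_halt (good : tm.Γ tm.k₁ → Prop) {D : ℕ} (hD : ∀ l, depth (tm.m l) ≤ D)
    {w : List (tm.Γ tm.k₀)} {a : tm.Γ tm.k₁} {t : ℕ}
    (h : TM2OutputsInTime tm w (some [a]) t) :
    ∃ N ≤ t * D, ∃ d, StepsTo (step (micro good)) (startState, inputStacks w) N d ∧
      step (micro good) d = none ∧ (Accepting (micro good) d ↔ good a) := by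
  obtain ⟨N, hN, ⟨⟨⟨s, hs⟩, v⟩, S⟩, h1, h2, h3, h4⟩ := exists_stepsTo good hD
    (c := initList tm w) (d := (startState, inputStacks w)) ⟨rfl, rfl, means_inputStacks w⟩
    h.evals_in_steps
  obtain rfl : s = .halt := h2
  refine ⟨N, hN.trans (Nat.mul_le_mul_right _ h.steps_le_m), _, h1, rfl, ?_⟩
  have h5 := h4.head tm.k₁
  have h6 : (haltList tm [a]).stk tm.k₁ = [a] := by simp [haltList]
  rw [h6] at h5
  constructor
  · rintro ⟨k, f, hk, hf⟩
    obtain ⟨rfl, rfl⟩ := Instr.halt.inj (show Instr.halt tm.k₁ _ = Instr.halt k f from hk)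
    obtain ⟨g, hg, hg'⟩ := hf
    rw [h5] at hg
    obtain rfl : a = g := by simpa using hg
    exact hg'
  · intro ha
    exact ⟨tm.k₁, _, rfl, a, h5, ha⟩

theorem reaches_of_stepsTo {σ : Type} {f : σ → Option σ} {b : σ} :
    ∀ {n : ℕ} {a : σ}, StepsTo f a n b → StateTransition.Reaches f a b
  | 0, a, h => by
    obtain rfl : a = b := by simpa [StepsTo] using h
    exact .refl
  | n + 1, a, h => by
    obtain ⟨a', h1, h2⟩ := stepsTo_succ h
    exact .head h1 (reaches_of_stepsTo h2)

/-- The micro machine is deterministic and the given run ends in a halted configuration. An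
accepting configuration is halted too, so the two coincide, and acceptance there is decided by the
output. -/
theorem good_of_accepts (good : tm.Γ tm.k₁ → Prop) {w : List (tm.Γ tm.k₀)} {a : tm.Γ tm.k₁}
    {t : ℕ} (h : TM2OutputsInTime tm w (some [a]) t) {d : Micro tm × (tm.K → List (Symbol tm))}
    (hd : Reaches (micro good) (startState, inputStacks w) d) (ha : Accepting (micro good) d) :
    good a := by
  have := tm.ΛFin
  obtain ⟨D, hD⟩ : ∃ D, ∀ l, depth (tm.m l) ≤ D :=
    ⟨Finset.univ.sup fun l => depth (tm.m l), fun l => Finset.le_sup (f := fun l => depth (tm.m l))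
      (Finset.mem_univ l)⟩
  obtain ⟨N, -, d', h1, h2, h3⟩ := exists_stepsTo_halt good hD h
  have hd0 : step (micro good) d = none := by
    obtain ⟨k, f, hk, -⟩ := ha
    simp [step, hk]
  have : d' = d := by
    -- Of two configurations reached by a deterministic machine one reaches the other; since neither
    -- has a successor, they are equal.
    rcases StateTransition.reaches_total (reaches_of_stepsTo h1) hd with h4 | h4
    · rcases h4.cases_head with h5 | ⟨e, h5, -⟩
      · exact h5
      · rw [h2] at h5
        cases h5
    · rcases h4.cases_head with h5 | ⟨e, h5, -⟩
      · exact h5.symm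
      · rw [hd0] at h5
        cases h5
  exact h3.1 (this ▸ ha)

end StackMachine

/-! ### The instance of a queue machine is computed in polynomial time -/

namespace NonAtomic

open StackProg StackMachine

theorem Arc.map_map {Q G Q' G' Q'' G'' : Type} (f : Q → Q') (g : G → G') (f' : Q' → Q'')
    (g' : G' → G'') (r : Arc Q G) : (r.map f g).map f' g' = r.map (f' ∘ f) (g' ∘ g) := by
  obtain ⟨s, a, t⟩ := r
  cases a <;> rfl

/-- A coding of the phases and letters by numbers. -/
structure Coding (C A : Type) where
  phases : ℕ
  letters : ℕ
  phase : Phase C A → ℕ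
  letter : A → ℕ
  phase_lt : ∀ f, phase f < phases
  letter_lt : ∀ a, letter a < letters
  phase_injective : Function.Injective phase
  letter_injective : Function.Injective letter

namespace Coding

variable {C A : Type} (e : Coding C A)

/-- The shift by one reserves `0` for the goal, which is where the instance expects it. -/
def state : MState C A → ℕ
  | none => 0
  | some (i, f) => i * e.phases + e.phase f + 1

def fact (f : ℕ × A) : ℕ := f.1 * e.letters + e.letter f.2

theorem eq_of_mul_add_eq {i j r s B : ℕ} (hr : r < B) (hs : s < B) (h : i * B + r = j * B + s) :
    i = j ∧ r = s := by
  have h1 := congrArg (· / B) h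
  have h2 := congrArg (· % B) h
  have hB : 0 < B := by omega
  simp only [Nat.mul_comm _ B, Nat.mul_add_div hB, Nat.div_eq_of_lt hr, Nat.div_eq_of_lt hs,
    Nat.mul_add_mod, Nat.mod_eq_of_lt hr, Nat.mod_eq_of_lt hs] at h1 h2
  exact ⟨h1, h2⟩

theorem state_injective : Function.Injective e.state := by
  rintro (_ | ⟨i, f⟩) (_ | ⟨j, g⟩) h
  · rfl
  · simp [state] at h
  · simp [state] at h
  · obtain ⟨h1, h2⟩ := eq_of_mul_add_eq (e.phase_lt f) (e.phase_lt g) (Nat.succ.inj h)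
    exact congrArg some (Prod.ext h1 (e.phase_injective h2))

theorem fact_injective : Function.Injective e.fact := by
  rintro ⟨i, a⟩ ⟨j, b⟩ h
  obtain ⟨h1, h2⟩ := eq_of_mul_add_eq (e.letter_lt a) (e.letter_lt b) h
  exact Prod.ext h1 (e.letter_injective h2)

theorem state_le {i K : ℕ} (hi : i ≤ K) (f : Phase C A) :
    e.state (some (i, f)) ≤ (K + 1) * e.phases := by
  have h1 := Nat.mul_le_mul_right e.phases hi
  have h2 := e.phase_lt f
  simp only [state, Nat.succ_mul]
  omega

theorem fact_le {i K : ℕ} (hi : i ≤ K) (a : A) : e.fact (i, a) ≤ (K + 1) * e.letters := by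
  have h1 := Nat.mul_le_mul_right e.letters hi
  have h2 := e.letter_lt a
  simp only [fact, Nat.succ_mul]
  omega

/-- Rules in which positions are affine forms. -/
abbrev Template (C A : Type) : Type := Arc (Option (Affine × Phase C A)) (Affine × A)

def evalState (r u : ℕ) (s : Option (Affine × Phase C A)) : MState C A :=
  s.map fun s => (s.1.eval r u, s.2)

def evalFact (r u : ℕ) (f : Affine × A) : ℕ × A := (f.1.eval r u, f.2)

def codeState : Option (Affine × Phase C A) → Affine
  | none => ⟨0, 0, 0⟩
  | some (P, f) => ⟨P.a * e.phases, P.b * e.phases, P.c * e.phases + e.phase f + 1⟩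

def codeFact (f : Affine × A) : Affine :=
  ⟨f.1.a * e.letters, f.1.b * e.letters, f.1.c * e.letters + e.letter f.2⟩

theorem state_evalState (r u : ℕ) (s : Option (Affine × Phase C A)) :
    e.state (evalState r u s) = (e.codeState s).eval r u := by
  cases s with
  | none => simp [evalState, state, codeState, Affine.eval]
  | some s => simp only [evalState, state, codeState, Affine.eval, Option.map_some]; ring

theorem fact_evalFact (r u : ℕ) (f : Affine × A) :
    e.fact (evalFact r u f) = (e.codeFact f).eval r u := by
  simp only [evalFact, fact, codeFact, Affine.eval]
  ring

def instantiate (l : List (Template C A)) (r u : ℕ) : List (Arc (MState C A) (ℕ × A)) :=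
  l.map (Arc.map (evalState r u) (evalFact r u))

def code (l : List (Template C A)) : List (Arc Affine Affine) :=
  l.map (Arc.map e.codeState e.codeFact)

/-- The coding is affine in the position, so it commutes with instantiation. The generator can thus
work with a fixed list of numerical templates, while correctness is argued with uncoded states and
facts. -/
theorem map_instantiate (l : List (Template C A)) (r u : ℕ) :
    (instantiate l r u).map (Arc.map e.state e.fact) = Affine.arcs (e.code l) r u := by
  simp only [instantiate, Affine.arcs, code, List.map_map]
  refine List.map_congr_left fun t _ => ?_
  simp only [Function.comp_apply, Affine.arc, Arc.map_map]
  congr 1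
  · exact funext fun s => e.state_evalState r u s
  · exact funext fun f => e.fact_evalFact r u f

/-- The instances of the templates for all `r < v`. -/
def instantiateRange (l : List (Template C A)) (v u : ℕ) : List (Arc (MState C A) (ℕ × A)) :=
  (List.range v).reverse.flatMap fun r => instantiate l r u

theorem map_instantiateRange (l : List (Template C A)) (v u : ℕ) :
    (instantiateRange l v u).map (Arc.map e.state e.fact) = forArcs (e.code l) v u := by
  simp only [instantiateRange, forArcs, List.map_flatMap, map_instantiate]

/-- The instances of the templates for all letters of a word. -/
def instantiateInput (l : Bool → List (Template C A)) :
    ℕ → List Bool → List (Arc (MState C A) (ℕ × A))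
  | _, [] => []
  | j, b :: x => instantiateInput l (j + 1) x ++ instantiate (l b) j 0

theorem map_instantiateInput (l : Bool → List (Template C A)) : ∀ (j : ℕ) (x : List Bool),
    (instantiateInput l j x).map (Arc.map e.state e.fact) =
      inputArcs (fun b => e.code (l b)) 0 j x
  | _, [] => rfl
  | j, b :: x => by
    simp [instantiateInput, inputArcs, map_instantiate, map_instantiateInput l (j + 1) x]

theorem mem_instantiateRange {l : List (Template C A)} {v u : ℕ} {a : Arc (MState C A) (ℕ × A)} :
    a ∈ instantiateRange l v u ↔
      ∃ r < v, ∃ t ∈ l, a = t.map (evalState r u) (evalFact r u) := by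
  simp [instantiateRange, instantiate, eq_comm]

theorem mem_instantiateInput {l : Bool → List (Template C A)} {a : Arc (MState C A) (ℕ × A)} :
    ∀ {j : ℕ} {x : List Bool}, a ∈ instantiateInput l j x ↔
      ∃ (i : ℕ) (hi : i < x.length), ∃ t ∈ l x[i],
        a = t.map (evalState (j + i) 0) (evalFact (j + i) 0)
  | j, [] => by simp [instantiateInput]
  | j, b :: x => by
    rw [instantiateInput, List.mem_append, mem_instantiateInput, instantiate, List.mem_map]
    constructor
    · rintro (⟨i, hi, t, ht, rfl⟩ | ⟨t, ht, rfl⟩)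
      · exact ⟨i + 1, Nat.succ_lt_succ hi, t, ht, by rw [Nat.add_right_comm, Nat.add_assoc]⟩
      · exact ⟨0, Nat.succ_pos _, t, ht, rfl⟩
    · rintro ⟨_ | i, hi, t, ht, rfl⟩
      · exact .inr ⟨t, ht, rfl⟩
      · exact .inl ⟨i, Nat.lt_of_succ_lt_succ hi, t, ht, by rw [Nat.add_right_comm, Nat.add_assoc]⟩

end Coding

/-! ### Rule templates and the reduction for queue machines -/

namespace QueueMachine

open Coding

variable {C A : Type} (m : QueueMachine C A)

def inputTemplates (b : Bool) : List (Template C A) :=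
  [⟨some (⟨1, 0, 1⟩, .guess), .write (⟨1, 0, 1⟩, m.input b), some (⟨1, 0, 2⟩, .guess)⟩]

def guessTemplates : List (Template C A) := [false, true].map fun b =>
  ⟨some (⟨1, 1, 1⟩, .guess), .write (⟨1, 1, 1⟩, m.guess b), some (⟨1, 1, 2⟩, .guess)⟩

def blankTemplates : List (Template C A) :=
  [⟨some (⟨1, 1, 1⟩, .guess), .write (⟨1, 1, 1⟩, m.blank), some (⟨1, 1, 2⟩, .blank)⟩,
    ⟨some (⟨1, 1, 1⟩, .blank), .write (⟨1, 1, 1⟩, m.blank), some (⟨1, 1, 2⟩, .blank)⟩]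

open scoped Classical in
-- Here `r` counts the steps of the queue machine and `u` is the queue length: reading happens at
-- `r`, writing at `r + u`.
noncomputable def runTemplates [Fintype C] [Fintype A] : List (Template C A) :=
  [⟨some (⟨1, 1, 0⟩, .blank), .silent, some (⟨1, 1, 0⟩, .run m.init)⟩,
    ⟨some (⟨1, 1, 0⟩, .run m.accept), .silent, none⟩] ++
  (((Finset.univ : Finset (C × A × A × C)).filter
    fun t => m.trans t.1 t.2.1 t.2.2.1 t.2.2.2).toList.map fun t =>
      ⟨some (⟨1, 1, 0⟩, .run t.1), .read (⟨1, 0, 0⟩, t.2.1),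
        some (⟨1, 1, 0⟩, .emit t.2.2.1 t.2.2.2)⟩) ++
  ((Finset.univ : Finset (A × C)).toList.map fun t =>
      ⟨some (⟨1, 1, 0⟩, .emit t.1 t.2), .write (⟨1, 1, 0⟩, t.1), some (⟨1, 1, 1⟩, .run t.2)⟩)

/-- The list of the rules of the master. -/
noncomputable def rules [Fintype C] [Fintype A] (x : List Bool) (p W N : ℕ) :
    List (Arc (MState C A) (ℕ × A)) :=
  instantiateInput m.inputTemplates 0 x ++ (instantiateRange m.guessTemplates p x.length ++
    (instantiateRange m.blankTemplates W x.length ++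
      instantiateRange m.runTemplates N (x.length + 1 + W)))

theorem mem_rules [Fintype C] [Fintype A] {x : List Bool} {p W N : ℕ}
    {r : Arc (MState C A) (ℕ × A)} : r ∈ m.rules x p W N ↔ m.Rules x p W N r := by
  simp only [rules, List.mem_append, mem_instantiateInput, mem_instantiateRange]
  constructor
  · rintro (⟨i, hi, t, ht, rfl⟩ | ⟨j, hj, t, ht, rfl⟩ | ⟨j, hj, t, ht, rfl⟩ | ⟨j, hj, t, ht, rfl⟩)
    · obtain rfl := List.mem_singleton.1 ht
      simpa [Arc.map, Action.map, evalState, evalFact, Affine.eval] using Rules.input i hi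
    · obtain ⟨b, -, rfl⟩ := List.mem_map.1 ht
      simpa [Arc.map, Action.map, evalState, evalFact, Affine.eval] using Rules.guess j b hj
    · simp only [blankTemplates, List.mem_cons, List.not_mem_nil, or_false] at ht
      obtain rfl | rfl := ht
      · simpa [Arc.map, Action.map, evalState, evalFact, Affine.eval] using Rules.blankStart j hj
      · simpa [Arc.map, Action.map, evalState, evalFact, Affine.eval] using Rules.blank j hj
    · simp only [runTemplates, List.mem_append, List.mem_cons, List.not_mem_nil, or_false,
        List.mem_map, Finset.mem_toList, Finset.mem_filter, Finset.mem_univ, true_and] at ht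
      obtain ((rfl | rfl) | ⟨⟨c, a, b, c'⟩, h, rfl⟩) | ⟨⟨b, c⟩, rfl⟩ := ht
      · simpa [Arc.map, Action.map, evalState, evalFact, Affine.eval] using Rules.start j hj
      · simpa [Arc.map, Action.map, evalState, evalFact, Affine.eval] using Rules.accept j hj
      · simpa [Arc.map, Action.map, evalState, evalFact, Affine.eval] using Rules.read j hj h
      · simpa [Arc.map, Action.map, evalState, evalFact, Affine.eval] using Rules.write j hj b c
  · intro h
    cases h with
    | input i hi =>
      refine .inl ⟨i, hi, _, List.mem_singleton_self _, ?_⟩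
      simp [Arc.map, Action.map, evalState, evalFact, Affine.eval]
    | guess j b hj =>
      refine .inr (.inl ⟨j, hj, _, List.mem_map_of_mem (a := b) (by cases b <;> simp), ?_⟩)
      simp [Arc.map, Action.map, evalState, evalFact, Affine.eval]
    | blankStart j hj =>
      refine .inr (.inr (.inl ⟨j, hj, _, List.mem_cons_self, ?_⟩))
      simp [Arc.map, Action.map, evalState, evalFact, Affine.eval]
    | blank j hj =>
      refine .inr (.inr (.inl ⟨j, hj, _, List.mem_cons_of_mem _ List.mem_cons_self, ?_⟩))
      simp [Arc.map, Action.map, evalState, evalFact, Affine.eval]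
    | start j hj =>
      refine .inr (.inr (.inr ⟨j, hj, _, List.mem_append_left _ (List.mem_append_left _
        List.mem_cons_self), ?_⟩))
      simp [Arc.map, Action.map, evalState, Affine.eval]
    | accept j hj =>
      refine .inr (.inr (.inr ⟨j, hj, _, List.mem_append_left _ (List.mem_append_left _
        (List.mem_cons_of_mem _ List.mem_cons_self)), ?_⟩))
      simp [Arc.map, Action.map, evalState, Affine.eval]
    | @read j hj c c' a b h =>
      refine .inr (.inr (.inr ⟨j, hj, _, List.mem_append_left _ (List.mem_append_right _
        (List.mem_map_of_mem (a := (c, a, b, c')) (by simpa using h))), ?_⟩))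
      simp [Arc.map, Action.map, evalState, evalFact, Affine.eval]
    | write j hj b c =>
      refine .inr (.inr (.inr ⟨j, hj, _, List.mem_append_right _
        (List.mem_map_of_mem (a := (b, c)) (by simp)), ?_⟩))
      simp [Arc.map, Action.map, evalState, evalFact, Affine.eval]

/-- No position exceeds `x.length + 1 + W + N`, the length of the initial queue plus one letter per
step. -/
theorem Rules.bounded {m : QueueMachine C A} (e : Coding C A) {x : List Bool} {p W N : ℕ}
    (hpW : p ≤ W) {r : Arc (MState C A) (ℕ × A)} (h : m.Rules x p W N r) :
    (r.map e.state e.fact).Bounded ((x.length + 1 + W + N + 1) * e.phases)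
      ((x.length + 1 + W + N + 1) * e.letters) := by
  cases h with
  | start | read => exact ⟨e.state_le (by omega) _, by first | trivial | exact e.fact_le (by omega) _,
      e.state_le (by omega) _⟩
  | accept => exact ⟨e.state_le (by omega) _, trivial, Nat.zero_le _⟩
  | _ => exact ⟨e.state_le (by omega) _, e.fact_le (by omega) _, e.state_le (by omega) _⟩

/-- The store initially holds `0`, which must be the code of "position `0` holds the separator"; a
transposition moves the chosen letter to `0`. -/
theorem exists_coding [Finite C] [Finite A] (a₀ : A) : ∃ e : Coding C A, e.letter a₀ = 0 := by
  have : Finite (Phase C A) := by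
    refine Finite.of_injective (β := Bool ⊕ C ⊕ A × C) (fun f => match f with
      | .guess => .inl false
      | .blank => .inl true
      | .run c => .inr (.inl c)
      | .emit b c => .inr (.inr (b, c))) ?_
    intro f g h
    cases f <;> cases g <;> simp_all
  obtain ⟨B, ⟨f⟩⟩ := Finite.exists_equiv_fin (Phase C A)
  obtain ⟨k, ⟨g⟩⟩ := Finite.exists_equiv_fin A
  have hk : 0 < k := (g a₀).pos
  refine ⟨⟨B, k, fun s => (f s).val, fun a => (Equiv.swap (g a₀) ⟨0, hk⟩ (g a)).val,
    fun s => (f s).isLt, fun a => Fin.isLt _, fun s t h => f.injective (Fin.ext h),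
    fun a b h => g.injective ((Equiv.swap _ _).injective (Fin.ext h))⟩, ?_⟩
  simp

/-- The problem whether a queue machine accepts a word with a guess of polynomial length reduces to
the reachability problem. -/
theorem exists_reduction [Finite C] [Finite A] (p W N : Polynomial ℕ)
    (hpW : ∀ n, p.eval n < W.eval n)
    (hN : ∀ x y : List Bool, y.length ≤ p.eval x.length → ∀ k w,
      QueueRun m.trans k (m.init, m.queue (W.eval x.length) x y) (m.accept, w) →
      ∃ k < N.eval x.length, ∃ w,
        QueueRun m.trans k (m.init, m.queue (W.eval x.length) x y) (m.accept, w)) :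
    ∃ f : List Bool → Instance, (∀ x, (f x).Stackless) ∧
      Nonempty (Turing.TM2ComputableInPolyTime (Computability.encodingList Bool).encode
        encInstance f) ∧
      ∀ x, (f x).Reachable ↔ ∃ y : List Bool, y.length ≤ p.eval x.length ∧ ∃ k w,
        QueueRun m.trans k (m.init, m.queue (W.eval x.length) x y) (m.accept, w) := by
  have := Fintype.ofFinite C
  have := Fintype.ofFinite A
  obtain ⟨e, he⟩ := exists_coding (C := C) m.sep
  obtain ⟨lp, hlp⟩ := exists_hornerEval p
  obtain ⟨lW, hlW⟩ := exists_hornerEval W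
  obtain ⟨lN, hlN⟩ := exists_hornerEval N
  obtain ⟨lS, hlS⟩ := exists_hornerEval (Polynomial.X + 1 + W)
  obtain ⟨lC, hlC⟩ := exists_hornerEval ((Polynomial.X + 1 + W + N + 1) * Polynomial.C e.phases)
  obtain ⟨lM, hlM⟩ := exists_hornerEval ((Polynomial.X + 1 + W + N + 1) * Polynomial.C e.letters)
  simp only [Polynomial.eval_add, Polynomial.eval_mul, Polynomial.eval_X, Polynomial.eval_one,
    Polynomial.eval_C] at hlS hlC hlM
  -- The coefficient list of the variable itself: the base number of the first two loops is the
  -- input length.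
  have hX : ∀ n, hornerEval [0, 1] n = n := fun n => by simp [hornerEval]
  let g : Generator :=
    { maxValue := lM
      maxState := lC
      init := e.state (some (1, .guess))
      inputRules := fun b => e.code (m.inputTemplates b)
      loops := [([0, 1], lp, e.code m.guessTemplates), ([0, 1], lW, e.code m.blankTemplates),
        (lS, lN, e.code m.runTemplates)] }
  have hg : ∀ x, g.arcs x = (m.rules x (p.eval x.length) (W.eval x.length)
      (N.eval x.length)).map (Arc.map e.state e.fact) := by
    intro x
    simp [g, Generator.arcs, Generator.loopArcs, rules, map_instantiateInput,
      map_instantiateRange, hX, hlp, hlW, hlN, hlS]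
  have hinit : ∀ n, g.init ≤ hornerEval g.maxState n := fun n => by
    rw [show hornerEval g.maxState n = _ from hlC n]
    exact e.state_le (by omega) _
  have hb : ∀ x, ∀ r ∈ m.rules x (p.eval x.length) (W.eval x.length) (N.eval x.length),
      (r.map e.state e.fact).Bounded (hornerEval g.maxState x.length)
        (hornerEval g.maxValue x.length) := by
    intro x r hr
    rw [show hornerEval g.maxState x.length = _ from hlC _,
      show hornerEval g.maxValue x.length = _ from hlM _]
    exact (m.mem_rules.1 hr).bounded e (hpW _).le
  refine ⟨g.toInstance, fun x => stackless_memoryInstance .., ?_, fun x => ?_⟩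
  · refine nonempty_polyTime_toInstance g hinit fun x r hr => ?_
    rw [hg] at hr
    obtain ⟨r, hr', rfl⟩ := List.mem_map.1 hr
    exact hb x r hr'
  · rw [Generator.toInstance, hg, reachable_memoryInstance_iff (q₀ := some (1, .guess))
      (φ₀ := (0, m.sep)) (q₁ := none) e.state_injective e.fact_injective (by simp [fact, he]) rfl
      (hinit _) (hb x)]
    exact factReach_iff (fun r => m.mem_rules) (hpW _) (hN x)

end QueueMachine

end NonAtomic

/-! ### NP-hardness -/

namespace StackMachine

open Turing StackProg NonAtomic

instance {K G : Type} [Finite K] [Finite G] : Finite (Op K G) := by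
  refine Finite.of_injective (β := Unit ⊕ K × Option G ⊕ K × Option G) (fun o => match o with
    | .keep => .inl ()
    | .push k e => .inr (.inl (k, e))
    | .pop k e => .inr (.inr (k, e))) ?_
  intro o o' h
  cases o <;> cases o' <;> simp_all

instance {K G Q : Type} [Finite K] [Finite G] [Finite Q] : Finite (Control K G Q) := by
  refine Finite.of_injective (β := Unit ⊕ Q ⊕ Op K G × Q) (fun c => match c with
    | .accept => .inl ()
    | .top q => .inr (.inl q)
    | .sweep o q => .inr (.inr (o, q))) ?_
  intro c c' h
  cases c <;> cases c' <;> simp_all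

variable (tm : FinTM2)

/-- A row cell that holds a symbol of the input stack only. -/
def inputCell (a : tm.Γ tm.k₀) : tm.K → Option (Symbol tm) :=
  fun k => if k = tm.k₀ then some (.inl a) else none

/-- The queue machine that simulates `tm` on pairs of words. -/
def queueMachine (inputAlphabet : tm.Γ tm.k₀ ≃ Bool ⊕ Bool) (good : tm.Γ tm.k₁ → Prop) :
    QueueMachine (Control tm.K (Symbol tm) (Micro tm)) (Letter tm.K (Symbol tm)) where
  trans := Transition (micro good)
  init := .sweep .keep startState
  accept := .accept
  input b := some (inputCell tm (inputAlphabet.symm (.inl b)))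
  guess b := some (inputCell tm (inputAlphabet.symm (.inr b)))
  blank := some fun _ => none
  sep := none

variable {tm}

theorem represents_inputCells (w : List (tm.Γ tm.k₀)) (n : ℕ) :
    Represents (w.map (inputCell tm) ++ List.replicate n fun _ => none) (inputStacks w) := by
  intro k
  by_cases hk : k = tm.k₀
  · subst hk
    exact ⟨n, by simp [track, inputStacks, inputCell]⟩
  · refine ⟨w.length + n, ?_⟩
    have h : ((fun v => v k) ∘ inputCell tm) = fun _ => none := by
      funext a
      simp [inputCell, hk]
    simp [track, inputStacks, hk, h]

/-- The summand `2` covers the initial passage over the separator and the accepting step; all other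
steps are full rotations. -/
theorem exists_queueRun {good : tm.Γ tm.k₁ → Prop} {D : ℕ} (hD : ∀ l, depth (tm.m l) ≤ D)
    {w : List (tm.Γ tm.k₀)} {a : tm.Γ tm.k₁} {t : ℕ} (h : TM2OutputsInTime tm w (some [a]) t)
    (ha : good a) {l : List (tm.K → Option (Symbol tm))} (hl : Represents l (inputStacks w))
    (hlen : w.length + t * D < l.length) :
    ∃ k ≤ t * D * (l.length + 1) + 2, ∃ v, QueueRun (Transition (micro good)) k
      (.sweep .keep startState, none :: l.map some) (.accept, v) := by
  obtain ⟨n, hn, d, h1, -, h2⟩ := exists_stepsTo_halt good hD h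
  obtain ⟨v, h3⟩ := queueRun_of_stepsTo (h2.2 ha) hl (fun k => by
    have : (inputStacks (tm := tm) w k).length ≤ w.length := by
      unfold inputStacks
      split <;> simp
    omega) (by rintro rfl; simp at hlen) h1
  refine ⟨_, ?_, v, (QueueRun.single (w := l.map some)
    (Transition.turn (o := .keep) startState trivial)).trans h3⟩
  have := Nat.mul_le_mul_right (l.length + 1) hn
  omega

end StackMachine

/-! ### From a verifier to the reduction -/

namespace NonAtomic

open Turing StackProg StackMachine

theorem eval_mono (P : Polynomial ℕ) {m n : ℕ} (h : m ≤ n) : P.eval m ≤ P.eval n := by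
  rw [Polynomial.eval_eq_sum_range, Polynomial.eval_eq_sum_range]
  gcongr

/-- The letters written by the master are the encoded pair of input and certificate, so the queue
machine accepts for some guess exactly if the verifier accepts some certificate of admissible
length. -/
theorem exists_reduction_of_inNP {L : Language Bool} (hL : Complexity.InNP L) :
    ∃ f : List Bool → Instance, (∀ x, (f x).Stackless) ∧
      Nonempty (Turing.TM2ComputableInPolyTime (Computability.encodingList Bool).encode
        encInstance f) ∧
      ∀ x, x ∈ L ↔ (f x).Reachable := by
  obtain ⟨p, R, ⟨⟨⟨tm, α, β⟩, t, hR⟩⟩, hL⟩ := hL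
  have := tm.ΛFin
  have := tm.σFin
  have := tm.kFin
  have := tm.Γk₀Fin
  obtain ⟨D, hD⟩ : ∃ D, ∀ l, depth (tm.m l) ≤ D :=
    ⟨Finset.univ.sup fun l => depth (tm.m l), fun l => Finset.le_sup (f := fun l => depth (tm.m l))
      (Finset.mem_univ l)⟩
  let good : tm.Γ tm.k₁ → Prop := fun g => β g = true
  let word : List Bool → List Bool → List (tm.Γ tm.k₀) := fun x y =>
    x.map (fun b => α.symm (.inl b)) ++ y.map (fun b => α.symm (.inr b))
  have hout : ∀ x y, Nonempty (TM2OutputsInTime tm (word x y) (some [β.symm (R (x, y))])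
      (t.eval (x.length + y.length))) := by
    intro x y
    have h := hR (x, y)
    simp only [Computability.encodingProd, Computability.encodingList,
      Computability.encodingBoolBool, Computability.encodeBool, id, List.map_append, List.map_map,
      List.length_append, List.length_map] at h
    exact ⟨h⟩
  -- `T` bounds the basic instructions for certificates of length at most `p`. The width `W` leaves
  -- room for the certificate, for one push per instruction and for one blank; `N` exceeds the
  -- number of instructions times the rotation length, plus the two extra steps.
  let T : Polynomial ℕ := t.comp (Polynomial.X + p) * Polynomial.C D
  let W : Polynomial ℕ := p + T + 1
  let N : Polynomial ℕ := (T + 1) * (Polynomial.X + W + 1) + 3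
  let row : List Bool → List Bool → List (tm.K → Option (Symbol tm)) := fun x y =>
    (word x y).map (inputCell tm) ++ List.replicate (W.eval x.length - y.length) fun _ => none
  have hq : ∀ x y, (queueMachine tm α good).queue (W.eval x.length) x y =
      none :: (row x y).map some := by
    intro x y
    simp [QueueMachine.queue, queueMachine, row, word, Function.comp_def]
  have hrun : ∀ x y : List Bool, y.length ≤ p.eval x.length → R (x, y) = true →
      ∃ k < N.eval x.length, ∃ w, QueueRun (Transition (micro good)) k
        (.sweep .keep startState, none :: (row x y).map some) (.accept, w) := by
    intro x y hy hxy
    obtain ⟨h⟩ := hout x y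
    have h1 : t.eval (x.length + y.length) * D ≤ T.eval x.length := by
      simp only [T, Polynomial.eval_mul, Polynomial.eval_comp, Polynomial.eval_add,
        Polynomial.eval_X, Polynomial.eval_C]
      exact Nat.mul_le_mul_right _ (eval_mono t (by omega))
    have h2 : W.eval x.length = p.eval x.length + T.eval x.length + 1 := by simp [W]
    have h3 : (row x y).length = x.length + W.eval x.length := by
      simp [row, word]
      omega
    obtain ⟨k, hk, w, h4⟩ := exists_queueRun (good := good) hD h (by simp [good, hxy])
      (represents_inputCells (word x y) (W.eval x.length - y.length)) (by
        change _ < (row x y).length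
        rw [h3]
        simp [word]
        omega)
    refine ⟨k, lt_of_le_of_lt hk ?_, w, h4⟩
    change _ * ((row x y).length + 1) + 2 < _
    rw [h3]
    have h5 : N.eval x.length = (T.eval x.length + 1) * (x.length + W.eval x.length + 1) + 3 := by
      simp [N]
    have h6 := Nat.mul_le_mul_right (x.length + W.eval x.length + 1) h1
    rw [h5, Nat.succ_mul]
    omega
  have hsound : ∀ x y k w, QueueRun (Transition (micro good)) k
      (.sweep .keep startState, none :: (row x y).map some) (.accept, w) → R (x, y) = true := by
    intro x y k w h
    obtain ⟨h0⟩ := hout x y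
    obtain ⟨c, h1, h2⟩ := accepts_of_queueRun
      (represents_inputCells (word x y) (W.eval x.length - y.length)) h
    simpa [good] using good_of_accepts good h0 h1 h2
  obtain ⟨f, hf1, hf2, hf3⟩ := (queueMachine tm α good).exists_reduction p W N
    -- An accepting run of any length shows that the verifier says yes, and this yields an accepting
    -- run within the time bound.
    (fun n => by simp [W]) (by
      intro x y hy k w h
      rw [hq] at h ⊢
      exact hrun x y hy (hsound x y k w h))
  refine ⟨f, hf1, hf2, fun x => ?_⟩
  rw [hL, hf3]
  refine exists_congr fun y => and_congr_right fun hy => ?_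
  rw [hq]
  constructor
  · intro h
    obtain ⟨k, -, w, hw⟩ := hrun x y hy h
    exact ⟨k, w, hw⟩
  · rintro ⟨k, w, h⟩
    exact hsound x y k w h

end NonAtomic

/-- The parameterised reachability problem for networks of non-atomic pushdown systems with a
single global store is NP-hard, and so is its restriction to instances without stacks. -/
theorem mainTheorem7 :
    Complexity.NPHard NonAtomic.instanceEncoding NonAtomic.Instance.Reachable ∧
      Complexity.NPHard
        (Complexity.subtypeEncoding NonAtomic.instanceEncoding NonAtomic.Instance.Stackless)
        (fun I => I.1.Reachable) := by
  constructor
  · intro L hL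
    obtain ⟨f, -, h2, h3⟩ := NonAtomic.exists_reduction_of_inNP hL
    exact ⟨f, h2, h3⟩
  · intro L hL
    obtain ⟨f, h1, ⟨h2⟩, h3⟩ := NonAtomic.exists_reduction_of_inNP hL
    -- An instance of the restricted problem has the same code as the underlying instance, so the
    -- same machine computes the reduction.
    exact ⟨fun x => ⟨f x, h1 x⟩, ⟨⟨h2.toTM2ComputableAux, h2.time, h2.outputsFun⟩⟩, h3⟩
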